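/- **Corollary 4.5.** Let $(\overline M,\overline g)$ and $(\widetilde M,\widetilde g)$ be connected smooth semi-Riemannian manifolds of dimensions $p$ and $n-p$, where $1\le p<n$ and $n\ge 3$, and let $f$ be a positive smooth function on $\overline M$. Let $M=\overline M\times_f\widetilde M$ be the warped product, that is, $\overline M\times\widetilde M$ with the metric $g=\pi^*\overline g+(f\circ\pi)\,\sigma^*\widetilde g$, where $\pi,\sigma$ are the natural projections. Let $\nabla,R$ be the Levi-Civita connection and the Riemann-Christoffel $(0,4)$-curvature tensor of $g$; a bar or a tilde denotes the same objects for $\overline g$ or $\widetilde g$. On $\overline M$ put $$T=-\frac1{2f}\Big(\overline\nabla df-\frac1{2f}\,df\otimes df\Big),\qquad P=\frac1{4f^2}\,\overline g^{ab}\,\partial_af\,\partial_bf ,$$ and on $\widetilde M$ put $\widetilde G_{\alpha\beta\gamma\delta}=\widetilde g_{\alpha\delta}\widetilde g_{\beta\gamma}-\widetilde g_{\alpha\gamma}\widetilde g_{\beta\delta}$. A semi-Riemannian manifold with curvature tensor $R$ is called recurrent if there is a smooth 1-form $\theta$ on it with $\nabla R=\theta\otimes R$ at all points where $\nabla R\ne0$.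 Suppose that $M$ is not flat ($R\not\equiv 0$) and that $\nabla R=\Pi\otimes R$ on $M$ for a smooth 1-form $\Pi$ on $M$. Let $\overline\Pi_{(x,y)}$ and $\widetilde\Pi_{(x,y)}$ be the restrictions of $\Pi_{(x,y)}$ to $T_x\overline M$ and $T_y\widetilde M$. Then: 1. $\overline M$ and $\widetilde M$ are both recurrent; more precisely, at every $(x,y)\in M$, $\overline\nabla\,\overline R=\overline\Pi\otimes\overline R$ and $\widetilde\nabla\widetilde R=\widetilde\Pi\otimes\widetilde R$. Also $T$ is recurrent with the same 1-form: $\overline\nabla T=\overline\Pi\otimes T$ at every $(x,y)\in M$. 2. At every $(x,y)\in M$ with $\widetilde\Pi_{(x,y)}\neq0$ one has $\overline R_x=0$, $T_x=0$ and $P(x)=0$. 3. $\widetilde M$ is of constant curvature on the set $\{(x,y)\in M: df_x\ne0\}\cup\{(x,y)\in M:(df+f\,\overline\Pi)_{(x,y)}\ne0\}$: there is a constant $k\in\mathbb R$ such that $\widetilde R_y=k\,\widetilde G_y$ for every $(x,y)$ in this set. -/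

import Mathlib

open scoped Manifold ContDiff

noncomputable section

namespace SemiRiem

/-! ### Tensor calculus in a coordinate domain

Here `G : E → E →L[ℝ] E →L[ℝ] ℝ` is a metric written in coordinates of a finite-dimensional
vector space `E`; vectors of `E` play the role of (combinations of) coordinate fields. -/

section Coordinates

variable {E : Type*} [NormedAddCommGroup E] [NormedSpace ℝ E]

/-- The Levi-Civita connection (Christoffel symbols) of `G` at `y`:
`Γ(u, v)` is the vector with
`G(Γ(u, v), w) = (1/2) (∂ᵤ G(v, w) + ∂ᵥ G(u, w) - ∂_w G(u, v))` for all `w`. -/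
def christoffel (G : E → E →L[ℝ] E →L[ℝ] ℝ) (y u v : E) : E :=
  (G y).inverse ((1 / 2 : ℝ) •
    (fderiv ℝ G y u v + fderiv ℝ G y v u - ((fderiv ℝ G y).flip u).flip v))

/-- The curvature operator `R(u, v) w = ∇ᵤ ∇ᵥ w - ∇ᵥ ∇ᵤ w` (for coordinate fields `u, v, w`). -/
def curvOp (G : E → E →L[ℝ] E →L[ℝ] ℝ) (y u v w : E) : E :=
  fderiv ℝ (fun z => christoffel G z v w) y u - fderiv ℝ (fun z => christoffel G z u w) y v
    + christoffel G y u (christoffel G y v w) - christoffel G y v (christoffel G y u w)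

/-- The Riemann-Christoffel tensor `R(u, v, w, t) = G(R(u, v) w, t)`. -/
def coordRiem (G : E → E →L[ℝ] E →L[ℝ] ℝ) (y u v w t : E) : ℝ :=
  G y (curvOp G y u v w) t

/-- The covariant derivative `(∇ₘ S)(u, v, w, t)` of a `(0,4)`-tensor field `S`. -/
def coordCov4 (G : E → E →L[ℝ] E →L[ℝ] ℝ) (S : E → E → E → E → E → ℝ) (y m u v w t : E) : ℝ :=
  fderiv ℝ (fun z => S z u v w t) y m
    - S y (christoffel G y m u) v w t - S y u (christoffel G y m v) w t
    - S y u v (christoffel G y m w) t - S y u v w (christoffel G y m t)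

/-- The covariant derivative `(∇ₘ S)(u, v)` of a `(0,2)`-tensor field `S`. -/
def coordCov2 (G : E → E →L[ℝ] E →L[ℝ] ℝ) (S : E → E → E → ℝ) (y m u v : E) : ℝ :=
  fderiv ℝ (fun z => S z u v) y m
    - S y (christoffel G y m u) v - S y u (christoffel G y m v)

/-- The Hessian `(∇ df)(u, v)` of a function. -/
def coordHess (G : E → E →L[ℝ] E →L[ℝ] ℝ) (f : E → ℝ) (y u v : E) : ℝ :=
  fderiv ℝ (fun z => fderiv ℝ f z u) y v - fderiv ℝ f y (christoffel G y v u)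

/-- The tensor `T = -(1/(2f)) (∇ df - (1/(2f)) df ⊗ df)`. -/
def coordT (G : E → E →L[ℝ] E →L[ℝ] ℝ) (f : E → ℝ) (y u v : E) : ℝ :=
  -(1 / (2 * f y)) *
    (coordHess G f y u v - 1 / (2 * f y) * (fderiv ℝ f y u * fderiv ℝ f y v))

end Coordinates

/-! ### Tensors on manifolds

A tensor at `x : M` is evaluated on `TangentSpace I x`, which in Mathlib is the model space `E`,
a vector being identified with its components in the preferred chart at `x`. Hence the value at
`x` of a tensor field is computed from the coordinate formulas in the preferred chart at `x`. -/

section Manifold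

variable {E : Type*} [NormedAddCommGroup E] [NormedSpace ℝ E]
  {H : Type*} [TopologicalSpace H] (I : ModelWithCorners ℝ E H)
  {M : Type*} [TopologicalSpace M] [ChartedSpace H M]

/-- A smooth 1-form: a smooth section of the cotangent bundle. -/
def IsSmoothOneForm [IsManifold I ∞ M] (θ : ∀ x : M, TangentSpace I x →L[ℝ] ℝ) : Prop :=
  ContMDiff I (I.prod 𝓘(ℝ, E →L[ℝ] ℝ)) ∞
    (fun x => Bundle.TotalSpace.mk' (E →L[ℝ] ℝ) (E := fun x : M => TangentSpace I x →L[ℝ] ℝ)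
      x (θ x))

/-- A semi-Riemannian metric: a smooth, symmetric, nondegenerate field of bilinear forms. -/
structure IsSemiRiemannianMetric [IsManifold I ∞ M]
    (g : ∀ x : M, TangentSpace I x →L[ℝ] TangentSpace I x →L[ℝ] ℝ) : Prop where
  symm : ∀ x v w, g x v w = g x w v
  nondegenerate : ∀ x v, (∀ w, g x v w = 0) → v = 0
  smooth : ContMDiff I (I.prod 𝓘(ℝ, E →L[ℝ] E →L[ℝ] ℝ)) ∞
    (fun x => Bundle.TotalSpace.mk' (E →L[ℝ] E →L[ℝ] ℝ)
      (E := fun x : M => TangentSpace I x →L[ℝ] TangentSpace I x →L[ℝ] ℝ) x (g x))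

variable {I}

/-- The pull-back `(v, w) ↦ b (A v) (A w)` of a bilinear form. -/
def pullForm {V W : Type*} [AddCommGroup V] [Module ℝ V] [TopologicalSpace V]
    [AddCommGroup W] [Module ℝ W] [TopologicalSpace W]
    [IsTopologicalAddGroup V] [ContinuousSMul ℝ V] [IsTopologicalAddGroup W] [ContinuousSMul ℝ W]
    (b : W →L[ℝ] W →L[ℝ] ℝ) (A : V →L[ℝ] W) : V →L[ℝ] V →L[ℝ] ℝ :=
  (ContinuousLinearMap.precomp ℝ A).comp (b.comp A)

/-- The metric `g` written in the preferred chart at `x`. -/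
def chartMetric (g : ∀ x : M, TangentSpace I x →L[ℝ] TangentSpace I x →L[ℝ] ℝ) (x : M) (y : E) :
    E →L[ℝ] E →L[ℝ] ℝ :=
  pullForm (V := E) (g ((extChartAt I x).symm y)) (mfderiv 𝓘(ℝ, E) I (extChartAt I x).symm y)

variable (g : ∀ x : M, TangentSpace I x →L[ℝ] TangentSpace I x →L[ℝ] ℝ)

/-- The Riemann-Christoffel curvature tensor `R` of `g` at `x`. -/
def riem (x : M) (u v w t : TangentSpace I x) : ℝ :=
  coordRiem (chartMetric g x) (extChartAt I x x) u v w t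

/-- The covariant derivative `(∇ₘ R)(u, v, w, t)` of the curvature tensor of `g` at `x`. -/
def covRiem (x : M) (m u v w t : TangentSpace I x) : ℝ :=
  coordCov4 (chartMetric g x) (coordRiem (chartMetric g x)) (extChartAt I x x) m u v w t

/-- The tensor `G = (1/2) g ∧ g` (Kulkarni-Nomizu product). -/
def gaussTensor (x : M) (u v w t : TangentSpace I x) : ℝ :=
  g x u t * g x v w - g x u w * g x v t

/-- `(M, g)` is recurrent: `∇R = θ ⊗ R` on the set of points where `∇R ≠ 0`, for a smooth
1-form `θ` on `M`. -/
def IsRecurrent [IsManifold I ∞ M] : Prop :=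
  ∃ θ : ∀ x : M, TangentSpace I x →L[ℝ] ℝ, IsSmoothOneForm I θ ∧
    ∀ x, (∃ m u v w t, covRiem g x m u v w t ≠ 0) →
      ∀ m u v w t, covRiem g x m u v w t = θ x m * riem g x u v w t

/-- The differential of a real function, as a 1-form. -/
def differential (f : M → ℝ) (x : M) : TangentSpace I x →L[ℝ] ℝ :=
  mfderiv I 𝓘(ℝ, ℝ) f x

/-- The tensor `T = -(1/(2f)) (∇ df - (1/(2f)) df ⊗ df)` on the base `(M, g)`. -/
def warpT (f : M → ℝ) (x : M) (u v : TangentSpace I x) : ℝ :=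
  coordT (chartMetric g x) (f ∘ (extChartAt I x).symm) (extChartAt I x x) u v

/-- The covariant derivative `(∇ₘ T)(u, v)`. -/
def covWarpT (f : M → ℝ) (x : M) (m u v : TangentSpace I x) : ℝ :=
  coordCov2 (chartMetric g x) (coordT (chartMetric g x) (f ∘ (extChartAt I x).symm))
    (extChartAt I x x) m u v

/-- The function `P = (1/(4f²)) g(grad f, grad f)` on the base `(M, g)`. -/
def warpP (f : M → ℝ) (x : M) : ℝ :=
  1 / (4 * f x ^ 2) *
    differential (I := I) f x ((g x).inverse (differential (I := I) f x))

end Manifold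

/-! ### Warped products -/

section Warped

variable {E : Type*} [NormedAddCommGroup E] [NormedSpace ℝ E]
  {H : Type*} [TopologicalSpace H] {I : ModelWithCorners ℝ E H}
  {B : Type*} [TopologicalSpace B] [ChartedSpace H B]
  {E' : Type*} [NormedAddCommGroup E'] [NormedSpace ℝ E']
  {H' : Type*} [TopologicalSpace H'] {J : ModelWithCorners ℝ E' H'}
  {F : Type*} [TopologicalSpace F] [ChartedSpace H' F]

/-- The warped product metric `g = π^* gB + (f ∘ π) σ^* gF` on `B × F`, where `π` and `σ` are the
natural projections. -/
def warpedMetric (gB : ∀ x : B, TangentSpace I x →L[ℝ] TangentSpace I x →L[ℝ] ℝ) (f : B → ℝ)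
    (gF : ∀ y : F, TangentSpace J y →L[ℝ] TangentSpace J y →L[ℝ] ℝ) (z : B × F) :
    TangentSpace (I.prod J) z →L[ℝ] TangentSpace (I.prod J) z →L[ℝ] ℝ :=
  pullForm (gB z.1) (mfderiv (I.prod J) I Prod.fst z)
    + f z.1 • pullForm (gF z.2) (mfderiv (I.prod J) J Prod.snd z)

/-- The part of a 1-form on `B × F` along the base, at `z`. -/
def basePart (θ : ∀ z : B × F, TangentSpace (I.prod J) z →L[ℝ] ℝ) (z : B × F) :
    TangentSpace I z.1 →L[ℝ] ℝ :=
  (θ z).comp (ContinuousLinearMap.inl ℝ (TangentSpace I z.1) (TangentSpace J z.2))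

/-- The part of a 1-form on `B × F` along the fiber, at `z`. -/
def fiberPart (θ : ∀ z : B × F, TangentSpace (I.prod J) z →L[ℝ] ℝ) (z : B × F) :
    TangentSpace J z.2 →L[ℝ] ℝ :=
  (θ z).comp (ContinuousLinearMap.inr ℝ (TangentSpace I z.1) (TangentSpace J z.2))

end Warped

end SemiRiem

end

open SemiRiem

noncomputable section

namespace SemiRiem

/-! ### Metrics, connection and curvature on an open set of a vector space. -/

section CoordinateMetric

set_option maxSynthPendingDepth 3

variable {E : Type*} [NormedAddCommGroup E] [NormedSpace ℝ E]

/-! Write everything in a product chart. The Koszul formula gives the Christoffel symbols of the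
warped product, and from them `riemL_coordWarped`: R is the sum of the base curvature, f times the
fiber curvature, −f²P times the Gauss tensor of the fiber, and f times the products of T with the
fiber metric. Components with exactly one or three base vectors vanish. The components of ∇R are
then computed (`cov_base`, `cov_mixed`, `cov_fiber`, `cov_base_fiber`) and compared with those of Π
⊗ R.

Purely base and mixed components in base directions give the recurrence of the base curvature and of
T. In a fiber direction their covariant derivatives are zero, so Π(0,e) annihilates both tensors.
The component with one base vector u and three fiber vectors is zero in R, so Π drops out, leaving
the algebraic identity `rec_base_fiber`: df(u)(R̃ − fP G̃) = f T(u, grad f) G̃.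

If Π(0,e) ≠ 0 at a point, then R̄ = 0 and T = 0 there. Were df ≠ 0, the identity would give R̃ = fP
G̃, and every term of R would cancel. Hence df = 0 and P = 0, provided R vanishes nowhere. That is
`riem_ne_zero_of_recurrent`: ∇R = Π ⊗ R is a linear differential equation along segments, so the
zero set of R is open as well as closed, and the product is connected. It is here that values of R
at neighbouring points, each defined in its own chart, are compared, which requires naturality under
chart changes. Recurrence of the fiber follows, since the only obstruction is the product Π(0,e)P,
now known to vanish.

For constant curvature no Schur argument is needed: if df(u) ≠ 0 at one base point x, the identity
over x holds for all y, and its coefficients depend on x and u only. If df ≡ 0, the metric is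
locally a product up to constant scaling, and a nonzero base part of Π forces R̃ = 0, so k = 0. -/

/-- `G` is a smooth semi-Riemannian metric on the open subset `U` of `E`. -/
structure IsMetricOn (G : E → E →L[ℝ] E →L[ℝ] ℝ) (U : Set E) : Prop where
  isOpen : IsOpen U
  contDiffOn : ContDiffOn ℝ ∞ G U
  symm : ∀ y ∈ U, ∀ v w, G y v w = G y w v
  nondegenerate : ∀ y ∈ U, ∀ v, (∀ w, G y v w = 0) → v = 0

theorem _root_.ContDiffOn.fderiv_infty {W : Type*} [NormedAddCommGroup W] [NormedSpace ℝ W]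
    {φ : E → W} {U : Set E} (hφ : ContDiffOn ℝ ∞ φ U) (hU : IsOpen U) :
    ContDiffOn ℝ ∞ (fderiv ℝ φ) U :=
  hφ.fderiv_of_isOpen hU (by simp)

theorem _root_.ContDiffOn.differentiableAt_infty {W : Type*} [NormedAddCommGroup W]
    [NormedSpace ℝ W] {φ : E → W} {U : Set E} (hφ : ContDiffOn ℝ ∞ φ U) (hU : IsOpen U)
    {y : E} (hy : y ∈ U) : DifferentiableAt ℝ φ y :=
  (hφ.contDiffAt (hU.mem_nhds hy)).differentiableAt (by simp)

/-- Second derivatives are symmetric. -/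
theorem fderiv_fderiv_apply_comm {W : Type*} [NormedAddCommGroup W] [NormedSpace ℝ W]
    {φ : E → W} {U : Set E} (hφ : ContDiffOn ℝ ∞ φ U) (hU : IsOpen U) {y : E} (hy : y ∈ U)
    (u v : E) : fderiv ℝ (fderiv ℝ φ) y u v = fderiv ℝ (fderiv ℝ φ) y v u :=
  ((hφ.contDiffAt (hU.mem_nhds hy)).isSymmSndFDerivAt (by simp [minSmoothness_of_isRCLikeNormedField]; exact WithTop.coe_le_coe.2 (le_top : (2 : ℕ∞) ≤ ⊤))) u v

/-- The Koszul expression, as a trilinear form. -/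
def koszul (G : E → E →L[ℝ] E →L[ℝ] ℝ) (y : E) : E →L[ℝ] E →L[ℝ] E →L[ℝ] ℝ :=
  (1 / 2 : ℝ) • (fderiv ℝ G y + (fderiv ℝ G y).flip
    - (ContinuousLinearMap.flipₗᵢ ℝ E E ℝ).toContinuousLinearEquiv.toContinuousLinearMap.comp
        (fderiv ℝ G y).flip)

/-- The Christoffel symbols as a bilinear map. -/
def christoffelL (G : E → E →L[ℝ] E →L[ℝ] ℝ) (y : E) : E →L[ℝ] E →L[ℝ] E :=
  (ContinuousLinearMap.compL ℝ E (E →L[ℝ] ℝ) E (G y).inverse).comp (koszul G y)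

theorem koszul_apply (G : E → E →L[ℝ] E →L[ℝ] ℝ) (y u v w : E) :
    koszul G y u v w
      = (1 / 2 : ℝ) * (fderiv ℝ G y u v w + fderiv ℝ G y v u w - fderiv ℝ G y w u v) := rfl

theorem christoffelL_apply (G : E → E →L[ℝ] E →L[ℝ] ℝ) (y u v : E) :
    christoffelL G y u v = christoffel G y u v := rfl

/-- The curvature operator as a trilinear map. -/
def curvOpL (G : E → E →L[ℝ] E →L[ℝ] ℝ) (y : E) : E →L[ℝ] E →L[ℝ] E →L[ℝ] E :=
  fderiv ℝ (christoffelL G) y - (fderiv ℝ (christoffelL G) y).flip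
    + ((ContinuousLinearMap.compL ℝ E E E).bilinearComp (christoffelL G y) (christoffelL G y)
    - ((ContinuousLinearMap.compL ℝ E E E).bilinearComp (christoffelL G y)
        (christoffelL G y)).flip)

theorem curvOpL_apply (G : E → E →L[ℝ] E →L[ℝ] ℝ) (y u v w : E) :
    curvOpL G y u v w = fderiv ℝ (christoffelL G) y u v w - fderiv ℝ (christoffelL G) y v u w
      + (christoffel G y u (christoffel G y v w) - christoffel G y v (christoffel G y u w)) := rfl

/-- The curvature tensor as a quadrilinear form. -/
def riemL (G : E → E →L[ℝ] E →L[ℝ] ℝ) (y : E) : E →L[ℝ] E →L[ℝ] E →L[ℝ] E →L[ℝ] ℝ :=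
  (ContinuousLinearMap.compL ℝ E (E →L[ℝ] E) (E →L[ℝ] E →L[ℝ] ℝ)
    (ContinuousLinearMap.compL ℝ E E (E →L[ℝ] ℝ) (G y))).comp (curvOpL G y)

theorem riemL_apply (G : E → E →L[ℝ] E →L[ℝ] ℝ) (y u v w t : E) :
    riemL G y u v w t = G y (curvOpL G y u v w) t := rfl

namespace IsMetricOn

variable {G : E → E →L[ℝ] E →L[ℝ] ℝ} {U : Set E} (h : IsMetricOn G U)
include h

theorem mono {V : Set E} (hV : IsOpen V) (hVU : V ⊆ U) : IsMetricOn G V :=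
  ⟨hV, h.contDiffOn.mono hVU, fun y hy => h.symm y (hVU hy),
    fun y hy => h.nondegenerate y (hVU hy)⟩

theorem congr {G' : E → E →L[ℝ] E →L[ℝ] ℝ} (hG : ∀ y ∈ U, G' y = G y) : IsMetricOn G' U :=
  ⟨h.isOpen, h.contDiffOn.congr hG, fun y hy => by rw [hG y hy]; exact h.symm y hy,
    fun y hy => by rw [hG y hy]; exact h.nondegenerate y hy⟩

theorem ext_left {y : E} (hy : y ∈ U) {a b : E} (hab : ∀ w, G y a w = G y b w) : a = b := by
  refine sub_eq_zero.1 (h.nondegenerate y hy _ fun w => ?_)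
  simp [hab w]

theorem differentiableAt {y : E} (hy : y ∈ U) : DifferentiableAt ℝ G y :=
  h.contDiffOn.differentiableAt_infty h.isOpen hy

theorem fderiv_symm {y : E} (hy : y ∈ U) (m v w : E) :
    fderiv ℝ G y m v w = fderiv ℝ G y m w v := by
  have hd := (h.differentiableAt hy).hasFDerivAt
  have h1 := (hd.clm_apply (hasFDerivAt_const v y)).clm_apply (hasFDerivAt_const w y)
  have h2 := (hd.clm_apply (hasFDerivAt_const w y)).clm_apply (hasFDerivAt_const v y)
  have h3 := h1.congr_of_eventuallyEq (f₁ := fun z => G z w v)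
    (Filter.eventually_of_mem (h.isOpen.mem_nhds hy) fun z hz => (h.symm z hz w v))
  have := congrArg (fun L => L m) (h3.unique h2)
  simpa using this

theorem christoffel_symm {y : E} (hy : y ∈ U) (u v : E) :
    christoffel G y u v = christoffel G y v u := by
  have : koszul G y u v = koszul G y v u := by
    ext w
    simp only [koszul_apply, h.fderiv_symm hy w u v]
    ring
  rw [← christoffelL_apply, ← christoffelL_apply]
  simp only [christoffelL, ContinuousLinearMap.comp_apply, ContinuousLinearMap.compL_apply, this]

variable [FiniteDimensional ℝ E]

/-- Nondegeneracy is injectivity of v ↦ G(v, ·), and a space and its dual have equal finite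
dimension. Without this, `inverse` in the Christoffel symbols could be the default value zero. -/
theorem isInvertible {y : E} (hy : y ∈ U) : (G y).IsInvertible := by
  have hinj : Function.Injective (G y : E →ₗ[ℝ] E →L[ℝ] ℝ) :=
    fun a b hab => h.ext_left hy fun w => congrArg (fun L : E →L[ℝ] ℝ => L w) hab
  have hdim : Module.finrank ℝ E = Module.finrank ℝ (E →L[ℝ] ℝ) := by
    rw [← (LinearMap.toContinuousLinearMap (𝕜 := ℝ) (E := E) (F' := ℝ)).finrank_eq]
    exact Subspace.dual_finrank_eq.symm
  refine ⟨(LinearEquiv.ofInjectiveOfFinrankEq (G y : E →ₗ[ℝ] E →L[ℝ] ℝ) hinj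
    hdim).toContinuousLinearEquiv, ?_⟩
  ext v w
  rfl

theorem christoffel_spec {y : E} (hy : y ∈ U) (u v w : E) :
    G y (christoffel G y u v) w
      = (1 / 2 : ℝ) * (fderiv ℝ G y u v w + fderiv ℝ G y v u w - fderiv ℝ G y w u v) := by
  rw [christoffel, (h.isInvertible hy).self_apply_inverse]
  rfl

/-- Uniqueness in the Koszul formula: a guessed symbol is verified by pairing it with test vectors,
without inverting the metric. -/
theorem christoffel_eq {y : E} (hy : y ∈ U) (u v a : E)
    (ha : ∀ w, G y a w
      = (1 / 2 : ℝ) * (fderiv ℝ G y u v w + fderiv ℝ G y v u w - fderiv ℝ G y w u v)) :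
    christoffel G y u v = a :=
  h.ext_left hy fun w => by rw [ha, h.christoffel_spec hy]

theorem contDiffOn_inverse : ContDiffOn ℝ ∞ (fun y => (G y).inverse) U := by
  intro y hy
  have := ((h.isInvertible hy).contDiffAt_map_inverse (n := ∞)).comp y
    (h.contDiffOn.contDiffAt (h.isOpen.mem_nhds hy))
  exact this.contDiffWithinAt

theorem contDiffOn_christoffel (u v : E) : ContDiffOn ℝ ∞ (fun y => christoffel G y u v) U := by
  have hd := h.contDiffOn.fderiv_infty h.isOpen
  refine h.contDiffOn_inverse.clm_apply ?_
  refine contDiffOn_clm_apply.2 fun w => ?_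
  have e (a b c : E) : ContDiffOn ℝ ∞ (fun y => fderiv ℝ G y a b c) U :=
    ((hd.clm_apply contDiffOn_const).clm_apply contDiffOn_const).clm_apply contDiffOn_const
  exact (contDiffOn_const (c := (1 / 2 : ℝ))).smul (((e u v w).add (e v u w)).sub (e w u v))

theorem contDiffOn_christoffelL : ContDiffOn ℝ ∞ (christoffelL G) U :=
  contDiffOn_clm_apply.2 fun u => contDiffOn_clm_apply.2 fun v => h.contDiffOn_christoffel u v

/-- `curvOp` differentiates one component at a time; the bundled map can be differentiated once and
then evaluated on moving vectors by the product rule. -/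
theorem fderiv_christoffel {y : E} (hy : y ∈ U) (u v m : E) :
    fderiv ℝ (fun z => christoffel G z u v) y m = fderiv ℝ (christoffelL G) y m u v := by
  have hd := (h.contDiffOn_christoffelL.differentiableAt_infty h.isOpen hy).hasFDerivAt
  have := ((hd.clm_apply (hasFDerivAt_const u y)).clm_apply (hasFDerivAt_const v y)).fderiv
  refine (congrArg (fun L => L m) this).trans ?_
  simp

theorem curvOp_eq {y : E} (hy : y ∈ U) (u v w : E) :
    curvOp G y u v w = curvOpL G y u v w := by
  rw [curvOp, curvOpL_apply, h.fderiv_christoffel hy, h.fderiv_christoffel hy]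
  abel

theorem coordRiem_eq {y : E} (hy : y ∈ U) (u v w t : E) :
    coordRiem G y u v w t = riemL G y u v w t := by
  rw [coordRiem, riemL_apply, h.curvOp_eq hy]

theorem contDiffOn_riemL : ContDiffOn ℝ ∞ (riemL G) U := by
  have hc := h.contDiffOn_christoffelL
  have hd := hc.fderiv_infty h.isOpen
  refine contDiffOn_clm_apply.2 fun u => contDiffOn_clm_apply.2 fun v =>
    contDiffOn_clm_apply.2 fun w => contDiffOn_clm_apply.2 fun t => ?_
  have e (a b c : E) : ContDiffOn ℝ ∞ (fun y => fderiv ℝ (christoffelL G) y a b c) U :=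
    ((hd.clm_apply contDiffOn_const).clm_apply contDiffOn_const).clm_apply contDiffOn_const
  have e' (a b c : E) :
      ContDiffOn ℝ ∞ (fun y => christoffelL G y a (christoffelL G y b c)) U :=
    (hc.clm_apply contDiffOn_const).clm_apply (h.contDiffOn_christoffel b c)
  exact (h.contDiffOn.clm_apply (((e u v w).sub (e v u w)).add
    ((e' u v w).sub (e' v u w)))).clm_apply contDiffOn_const

/-- The covariant derivative of a quadrilinear form, through its bundled version. -/
theorem coordCov4_coordRiem {y : E} (hy : y ∈ U) (m u v w t : E) :
    coordCov4 G (coordRiem G) y m u v w t = fderiv ℝ (riemL G) y m u v w t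
      - riemL G y (christoffel G y m u) v w t - riemL G y u (christoffel G y m v) w t
      - riemL G y u v (christoffel G y m w) t - riemL G y u v w (christoffel G y m t) := by
  have hd := (h.contDiffOn_riemL.differentiableAt_infty h.isOpen hy).hasFDerivAt
  have h1 := (((hd.clm_apply (hasFDerivAt_const u y)).clm_apply
    (hasFDerivAt_const v y)).clm_apply (hasFDerivAt_const w y)).clm_apply (hasFDerivAt_const t y)
  have h2 := h1.congr_of_eventuallyEq (f₁ := fun z => coordRiem G z u v w t)
    (Filter.eventually_of_mem (h.isOpen.mem_nhds hy) fun z hz => h.coordRiem_eq hz u v w t)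
  rw [coordCov4, h2.fderiv]
  simp only [h.coordRiem_eq hy]
  simp

end IsMetricOn

end CoordinateMetric

/-! ### Naturality of R and ∇R under local isometries; propagation of zeros of R. -/

section Naturality

set_option maxSynthPendingDepth 3

variable {E : Type*} [NormedAddCommGroup E] [NormedSpace ℝ E]

/-- `φ` is a smooth local isometry from `(U, G)` to `(V, G')`. -/
structure IsIsometryOn (G G' : E → E →L[ℝ] E →L[ℝ] ℝ) (U V : Set E) (φ : E → E) : Prop where
  source : IsMetricOn G U
  target : IsMetricOn G' V
  contDiffOn : ContDiffOn ℝ ∞ φ U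
  mapsTo : Set.MapsTo φ U V
  pullback : ∀ y ∈ U, ∀ v w, G y v w = G' (φ y) (fderiv ℝ φ y v) (fderiv ℝ φ y w)

namespace IsIsometryOn

variable {G G' : E → E →L[ℝ] E →L[ℝ] ℝ} {U V : Set E} {φ : E → E}
  (h : IsIsometryOn G G' U V φ)
include h

theorem hasFDerivAt {y : E} (hy : y ∈ U) : HasFDerivAt φ (fderiv ℝ φ y) y :=
  (h.contDiffOn.differentiableAt_infty h.source.isOpen hy).hasFDerivAt

theorem hasFDerivAt_fderiv {y : E} (hy : y ∈ U) :
    HasFDerivAt (fderiv ℝ φ) (fderiv ℝ (fderiv ℝ φ) y) y :=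
  ((h.contDiffOn.fderiv_infty h.source.isOpen).differentiableAt_infty
    h.source.isOpen hy).hasFDerivAt

theorem hasFDerivAt_fderiv_fderiv {y : E} (hy : y ∈ U) :
    HasFDerivAt (fderiv ℝ (fderiv ℝ φ)) (fderiv ℝ (fderiv ℝ (fderiv ℝ φ)) y) y :=
  (((h.contDiffOn.fderiv_infty h.source.isOpen).fderiv_infty
    h.source.isOpen).differentiableAt_infty h.source.isOpen hy).hasFDerivAt

theorem fderiv_metric {y : E} (hy : y ∈ U) (m v w : E) :
    fderiv ℝ G y m v w
      = fderiv ℝ G' (φ y) (fderiv ℝ φ y m) (fderiv ℝ φ y v) (fderiv ℝ φ y w)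
        + G' (φ y) (fderiv ℝ (fderiv ℝ φ) y m v) (fderiv ℝ φ y w)
        + G' (φ y) (fderiv ℝ φ y v) (fderiv ℝ (fderiv ℝ φ) y m w) := by
  have hd := (h.source.differentiableAt hy).hasFDerivAt
  have hA := h.hasFDerivAt_fderiv hy
  have h1 := (hd.clm_apply (hasFDerivAt_const v y)).clm_apply (hasFDerivAt_const w y)
  have hG' := (h.target.differentiableAt (h.mapsTo hy)).hasFDerivAt.comp y (h.hasFDerivAt hy)
  have h2 := (hG'.clm_apply (hA.clm_apply (hasFDerivAt_const v y))).clm_apply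
    (hA.clm_apply (hasFDerivAt_const w y))
  have h3 := h2.congr_of_eventuallyEq (f₁ := fun z => G z v w)
    (Filter.eventually_of_mem (h.source.isOpen.mem_nhds hy) fun z hz => h.pullback z hz v w)
  have := congrArg (fun L => L m) (h1.unique h3)
  simp only [add_apply, ContinuousLinearMap.comp_apply,
    ContinuousLinearMap.flip_apply, zero_apply, map_zero, zero_add,
    Function.comp_apply] at this
  rw [this]
  ring

theorem injective {y : E} (hy : y ∈ U) : Function.Injective (fderiv ℝ φ y) := by
  refine (injective_iff_map_eq_zero _).2 fun v hv => h.source.nondegenerate y hy v fun w => ?_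
  rw [h.pullback y hy, hv, map_zero, zero_apply]

variable [FiniteDimensional ℝ E]

theorem surjective {y : E} (hy : y ∈ U) : Function.Surjective (fderiv ℝ φ y) :=
  (LinearMap.injective_iff_surjective (f := (fderiv ℝ φ y : E →ₗ[ℝ] E))).1 (h.injective hy)

/-- Transformation rule of the Christoffel symbols. -/
theorem fderiv_christoffel {y : E} (hy : y ∈ U) (u v : E) :
    fderiv ℝ φ y (christoffelL G y u v) = fderiv ℝ (fderiv ℝ φ) y u v
      + christoffelL G' (φ y) (fderiv ℝ φ y u) (fderiv ℝ φ y v) := by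
  have hy' := h.mapsTo hy
  refine h.target.ext_left hy' fun a => ?_
  obtain ⟨w, rfl⟩ := h.surjective hy a
  have hD := fderiv_fderiv_apply_comm h.contDiffOn h.source.isOpen hy
  rw [← h.pullback y hy, christoffelL_apply, h.source.christoffel_spec hy, map_add,
    add_apply, christoffelL_apply, h.target.christoffel_spec hy',
    h.fderiv_metric hy, h.fderiv_metric hy, h.fderiv_metric hy, hD v u, hD w u, hD w v,
    h.target.symm _ hy' (fderiv ℝ φ y v), h.target.symm _ hy' (fderiv ℝ φ y u)]
  ring

/-- The transformation rule of the Christoffel symbols, differentiated in the direction u by the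
product rule. -/
theorem fderiv_fderiv_christoffel {y : E} (hy : y ∈ U) (u v w : E) :
    fderiv ℝ φ y (fderiv ℝ (christoffelL G) y u v w)
      = fderiv ℝ (fderiv ℝ (fderiv ℝ φ)) y u v w
        + fderiv ℝ (christoffelL G') (φ y) (fderiv ℝ φ y u) (fderiv ℝ φ y v) (fderiv ℝ φ y w)
        + christoffelL G' (φ y) (fderiv ℝ (fderiv ℝ φ) y u v) (fderiv ℝ φ y w)
        + christoffelL G' (φ y) (fderiv ℝ φ y v) (fderiv ℝ (fderiv ℝ φ) y u w)
        - fderiv ℝ (fderiv ℝ φ) y u (christoffelL G y v w) := by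
  have hA := h.hasFDerivAt_fderiv hy
  have hG := (h.source.contDiffOn_christoffelL.differentiableAt_infty
    h.source.isOpen hy).hasFDerivAt
  have hG' := (h.target.contDiffOn_christoffelL.differentiableAt_infty
    h.target.isOpen (h.mapsTo hy)).hasFDerivAt.comp y (h.hasFDerivAt hy)
  have h1 := hA.clm_apply
    ((hG.clm_apply (hasFDerivAt_const v y)).clm_apply (hasFDerivAt_const w y))
  have h2 := (((h.hasFDerivAt_fderiv_fderiv hy).clm_apply (hasFDerivAt_const v y)).clm_apply
    (hasFDerivAt_const w y)).add
    ((hG'.clm_apply (hA.clm_apply (hasFDerivAt_const v y))).clm_apply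
      (hA.clm_apply (hasFDerivAt_const w y)))
  have h3 := h2.congr_of_eventuallyEq
    (f₁ := fun z => fderiv ℝ φ z (christoffelL G z v w))
    (Filter.eventually_of_mem (h.source.isOpen.mem_nhds hy)
      fun z hz => h.fderiv_christoffel hz v w)
  have := congrArg (fun L => L u) (h1.unique h3)
  simp only [add_apply, ContinuousLinearMap.comp_apply,
    ContinuousLinearMap.flip_apply, zero_apply, map_zero, zero_add,
    Function.comp_apply] at this
  rw [eq_sub_iff_add_eq, this]
  abel

/-- Curvature operators are natural under isometries. -/
theorem fderiv_curvOpL {y : E} (hy : y ∈ U) (u v w : E) :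
    fderiv ℝ φ y (curvOpL G y u v w)
      = curvOpL G' (φ y) (fderiv ℝ φ y u) (fderiv ℝ φ y v) (fderiv ℝ φ y w) := by
  -- The second and third derivatives of φ are symmetric in u and v, so the nontensorial terms
  -- cancel in the antisymmetrization.
  have hD := fderiv_fderiv_apply_comm h.contDiffOn h.source.isOpen hy u v
  have hD3 := congrArg (fun L => L w) (fderiv_fderiv_apply_comm
    (h.contDiffOn.fderiv_infty h.source.isOpen) h.source.isOpen hy u v)
  simp only [curvOpL_apply, ← christoffelL_apply, map_add, map_sub, h.fderiv_fderiv_christoffel hy,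
    h.fderiv_christoffel hy, hD, hD3]
  abel

theorem riemL_eq {y : E} (hy : y ∈ U) (u v w t : E) :
    riemL G y u v w t = riemL G' (φ y) (fderiv ℝ φ y u) (fderiv ℝ φ y v) (fderiv ℝ φ y w)
      (fderiv ℝ φ y t) := by
  rw [riemL_apply, riemL_apply, h.pullback y hy, h.fderiv_curvOpL hy]

/-- The curvature tensor is natural under isometries. -/
theorem coordRiem_eq {y : E} (hy : y ∈ U) (u v w t : E) :
    coordRiem G y u v w t = coordRiem G' (φ y) (fderiv ℝ φ y u) (fderiv ℝ φ y v)
      (fderiv ℝ φ y w) (fderiv ℝ φ y t) := by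
  rw [h.source.coordRiem_eq hy, h.target.coordRiem_eq (h.mapsTo hy), h.riemL_eq hy]

/-- The covariant derivative of the curvature tensor is natural under isometries. -/
theorem coordCov4_eq {y : E} (hy : y ∈ U) (m u v w t : E) :
    coordCov4 G (coordRiem G) y m u v w t = coordCov4 G' (coordRiem G') (φ y) (fderiv ℝ φ y m)
      (fderiv ℝ φ y u) (fderiv ℝ φ y v) (fderiv ℝ φ y w) (fderiv ℝ φ y t) := by
  have hA := h.hasFDerivAt_fderiv hy
  have hG := (h.source.contDiffOn_riemL.differentiableAt_infty h.source.isOpen hy).hasFDerivAt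
  have hG' := (h.target.contDiffOn_riemL.differentiableAt_infty
    h.target.isOpen (h.mapsTo hy)).hasFDerivAt.comp y (h.hasFDerivAt hy)
  have c (a : E) := hasFDerivAt_const (𝕜 := ℝ) a y
  have h1 := (((hG.clm_apply (c u)).clm_apply (c v)).clm_apply (c w)).clm_apply (c t)
  have h2 := (((hG'.clm_apply (hA.clm_apply (c u))).clm_apply
    (hA.clm_apply (c v))).clm_apply (hA.clm_apply (c w))).clm_apply (hA.clm_apply (c t))
  have h3 := h2.congr_of_eventuallyEq (f₁ := fun z => riemL G z u v w t)
    (Filter.eventually_of_mem (h.source.isOpen.mem_nhds hy)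
      fun z hz => h.riemL_eq hz u v w t)
  have := congrArg (fun L => L m) (h1.unique h3)
  simp only [add_apply, ContinuousLinearMap.comp_apply,
    ContinuousLinearMap.flip_apply, zero_apply, map_zero, zero_add,
    Function.comp_apply] at this
  rw [h.source.coordCov4_coordRiem hy, h.target.coordCov4_coordRiem (h.mapsTo hy), this]
  simp only [h.riemL_eq hy, ← christoffelL_apply, h.fderiv_christoffel hy, map_add,
    add_apply]
  ring

end IsIsometryOn

theorem norm_le_of_forall_norm_apply_le {L : E →L[ℝ] E →L[ℝ] E →L[ℝ] E →L[ℝ] ℝ} {C : ℝ}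
    (hC : 0 ≤ C) (hL : ∀ u v w t, ‖L u v w t‖ ≤ C * ‖u‖ * ‖v‖ * ‖w‖ * ‖t‖) : ‖L‖ ≤ C :=
  L.opNorm_le_bound hC fun u => (L u).opNorm_le_bound (by positivity) fun v =>
    (L u v).opNorm_le_bound (by positivity) fun w =>
      (L u v w).opNorm_le_bound (by positivity) fun t => hL u v w t

theorem norm_apply_apply_apply_apply_le (L : E →L[ℝ] E →L[ℝ] E →L[ℝ] E →L[ℝ] ℝ) (u v w t : E) :
    ‖L u v w t‖ ≤ ‖L‖ * ‖u‖ * ‖v‖ * ‖w‖ * ‖t‖ :=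
  (L u v w).le_of_opNorm_le ((L u v).le_of_opNorm_le
    ((L u).le_of_opNorm_le (L.le_opNorm u) v) w) t

/-- The recurrence expresses the ordinary derivative of R as α ⊗ R plus one Christoffel correction
for each of the four slots, all linear in R. This is the hypothesis of a Grönwall argument. -/
theorem IsMetricOn.norm_fderiv_riemL_le [FiniteDimensional ℝ E]
    {G : E → E →L[ℝ] E →L[ℝ] ℝ} {U : Set E} (h : IsMetricOn G U) {y : E} (hy : y ∈ U)
    {α : E →L[ℝ] ℝ} (hrec : ∀ m u v w t,
      coordCov4 G (coordRiem G) y m u v w t = α m * coordRiem G y u v w t) (m : E) :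
    ‖fderiv ℝ (riemL G) y m‖ ≤ (‖α‖ + 4 * ‖christoffelL G y‖) * ‖m‖ * ‖riemL G y‖ := by
  refine norm_le_of_forall_norm_apply_le (by positivity) fun u v w t => ?_
  have h1 := hrec m u v w t
  rw [h.coordCov4_coordRiem hy, h.coordRiem_eq hy] at h1
  simp only [← christoffelL_apply] at h1
  have h2 : fderiv ℝ (riemL G) y m u v w t = α m * riemL G y u v w t
      + riemL G y (christoffelL G y m u) v w t + riemL G y u (christoffelL G y m v) w t
      + riemL G y u v (christoffelL G y m w) t + riemL G y u v w (christoffelL G y m t) := by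
    linarith
  set L := riemL G y
  set Γ := christoffelL G y
  have hΓ (a : E) : ‖Γ m a‖ ≤ ‖Γ‖ * ‖m‖ * ‖a‖ := Γ.le_opNorm₂ m a
  have b0 : ‖α m * L u v w t‖ ≤ (‖α‖ * ‖m‖) * (‖L‖ * ‖u‖ * ‖v‖ * ‖w‖ * ‖t‖) := by
    rw [norm_mul]
    exact mul_le_mul (α.le_opNorm m) (norm_apply_apply_apply_apply_le L u v w t)
      (norm_nonneg _) (by positivity)
  have b1 : ‖L (Γ m u) v w t‖ ≤ ‖L‖ * (‖Γ‖ * ‖m‖ * ‖u‖) * ‖v‖ * ‖w‖ * ‖t‖ :=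
    (norm_apply_apply_apply_apply_le L _ _ _ _).trans (by gcongr; exact hΓ u)
  have b2 : ‖L u (Γ m v) w t‖ ≤ ‖L‖ * ‖u‖ * (‖Γ‖ * ‖m‖ * ‖v‖) * ‖w‖ * ‖t‖ :=
    (norm_apply_apply_apply_apply_le L _ _ _ _).trans (by gcongr; exact hΓ v)
  have b3 : ‖L u v (Γ m w) t‖ ≤ ‖L‖ * ‖u‖ * ‖v‖ * (‖Γ‖ * ‖m‖ * ‖w‖) * ‖t‖ :=
    (norm_apply_apply_apply_apply_le L _ _ _ _).trans (by gcongr; exact hΓ w)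
  have b4 : ‖L u v w (Γ m t)‖ ≤ ‖L‖ * ‖u‖ * ‖v‖ * ‖w‖ * (‖Γ‖ * ‖m‖ * ‖t‖) :=
    (norm_apply_apply_apply_apply_le L _ _ _ _).trans (by gcongr; exact hΓ t)
  rw [h2]
  refine (norm_add_le_of_le (norm_add_le_of_le (norm_add_le_of_le
    (norm_add_le_of_le b0 b1) b2) b3) b4).trans (le_of_eq ?_)
  ring

/-- If `∇R = α ⊗ R` with `α` bounded near `y₀` and `R` vanishes at `y₀`, then `R` vanishes
near `y₀`. -/
theorem IsMetricOn.eventually_coordRiem_eq_zero [FiniteDimensional ℝ E]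
    {G : E → E →L[ℝ] E →L[ℝ] ℝ} {U : Set E} (h : IsMetricOn G U) {α : E → E →L[ℝ] ℝ}
    {y₀ : E} (hy₀ : y₀ ∈ U) (hα : ContinuousAt α y₀)
    (hrec : ∀ᶠ y in nhds y₀, ∀ m u v w t,
      coordCov4 G (coordRiem G) y m u v w t = α y m * coordRiem G y u v w t)
    (h0 : ∀ u v w t, coordRiem G y₀ u v w t = 0) :
    ∀ᶠ y in nhds y₀, ∀ u v w t, coordRiem G y u v w t = 0 := by
  have hΓ : ContinuousAt (christoffelL G) y₀ :=
    (h.contDiffOn_christoffelL.differentiableAt_infty h.isOpen hy₀).continuousAt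
  -- By continuity the values at `y₀`, increased by 1, bound both coefficients on a whole ball, so
  -- one Grönwall constant serves every segment from `y₀`.
  have e1 := hα.norm.eventually_lt_const (lt_add_one ‖α y₀‖)
  have e2 := hΓ.norm.eventually_lt_const (lt_add_one ‖christoffelL G y₀‖)
  have e3 : ∀ᶠ y in nhds y₀, y ∈ U := h.isOpen.mem_nhds hy₀
  obtain ⟨r, hr, hball⟩ := Metric.eventually_nhds_iff_ball.1 ((e3.and hrec).and (e1.and e2))
  refine Filter.eventually_of_mem (Metric.ball_mem_nhds y₀ hr) fun y hy => ?_
  have hmem : ∀ s ∈ Set.Icc (0 : ℝ) 1, y₀ + s • (y - y₀) ∈ Metric.ball y₀ r := fun s hs =>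
    (convex_ball y₀ r).add_smul_sub_mem (Metric.mem_ball_self hr) hy hs
  have hderiv : ∀ s ∈ Set.Icc (0 : ℝ) 1, HasDerivAt (fun s : ℝ => riemL G (y₀ + s • (y - y₀)))
      (fderiv ℝ (riemL G) (y₀ + s • (y - y₀)) (y - y₀)) s := fun s hs => by
    have hl : HasDerivAt (fun s : ℝ => y₀ + s • (y - y₀)) (y - y₀) s := by
      simpa using ((hasDerivAt_id s).smul_const (y - y₀)).const_add y₀
    exact ((h.contDiffOn_riemL.differentiableAt_infty h.isOpen
      (hball _ (hmem s hs)).1.1).hasFDerivAt).comp_hasDerivAt s hl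
  -- Grönwall along the segment from `y₀` to `y`, for a curve of quadrilinear forms starting at
  -- zero.
  have hzero := eq_zero_of_abs_deriv_le_mul_abs_self_of_eq_zero_right
    (f := fun s : ℝ => riemL G (y₀ + s • (y - y₀)))
    (K := ((‖α y₀‖ + 1) + 4 * (‖christoffelL G y₀‖ + 1)) * ‖y - y₀‖)
    (fun s hs => (hderiv s hs).continuousAt.continuousWithinAt)
    (fun s hs => (hderiv s (Set.Ico_subset_Icc_self hs)).hasDerivWithinAt)
    (by
      ext u v w t
      simpa [h.coordRiem_eq hy₀] using h0 u v w t)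
    (fun s hs => by
      obtain ⟨⟨hU, hre⟩, hA, hG⟩ := hball _ (hmem s (Set.Ico_subset_Icc_self hs))
      refine (h.norm_fderiv_riemL_le hU hre (y - y₀)).trans ?_
      gcongr)
    1 (Set.right_mem_Icc.2 zero_le_one)
  intro u v w t
  simp only [one_smul, add_sub_cancel] at hzero
  rw [h.coordRiem_eq (hball y hy).1.1, hzero]
  rfl

end Naturality

/-! ### Warped products in coordinates: gradient, Hessian, T and Christoffel symbols. -/

section WarpedCoordinates

set_option maxSynthPendingDepth 3

variable {E : Type*} [NormedAddCommGroup E] [NormedSpace ℝ E]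
  {E' : Type*} [NormedAddCommGroup E'] [NormedSpace ℝ E']

/-- The Levi-Civita connection is metric. -/
theorem IsMetricOn.fderiv_eq_christoffelL [FiniteDimensional ℝ E] {G : E → E →L[ℝ] E →L[ℝ] ℝ}
    {U : Set E} (h : IsMetricOn G U) {y : E} (hy : y ∈ U) (m v w : E) :
    fderiv ℝ G y m v w = G y (christoffelL G y m v) w + G y v (christoffelL G y m w) := by
  rw [h.symm y hy v, christoffelL_apply, christoffelL_apply, h.christoffel_spec hy,
    h.christoffel_spec hy, h.fderiv_symm hy v m w, h.fderiv_symm hy w m v, h.fderiv_symm hy m w v]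
  ring

/-- The gradient of a function. -/
def coordGrad (G : E → E →L[ℝ] E →L[ℝ] ℝ) (f : E → ℝ) (y : E) : E :=
  (G y).inverse (fderiv ℝ f y)

/-- The function `P = (1/(4f²)) G(grad f, grad f)`. -/
def coordP (G : E → E →L[ℝ] E →L[ℝ] ℝ) (f : E → ℝ) (y : E) : ℝ :=
  1 / (4 * f y ^ 2) * fderiv ℝ f y (coordGrad G f y)

/-- The tensor `G(u, t) G(v, w) - G(u, w) G(v, t)`. -/
def coordGauss (G : E → E →L[ℝ] E →L[ℝ] ℝ) (y u v w t : E) : ℝ :=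
  G y u t * G y v w - G y u w * G y v t

/-- The warped product of the metrics `GB` and `GF`. -/
def coordWarped (GB : E → E →L[ℝ] E →L[ℝ] ℝ) (f : E → ℝ) (GF : E' → E' →L[ℝ] E' →L[ℝ] ℝ)
    (z : E × E') : (E × E') →L[ℝ] (E × E') →L[ℝ] ℝ :=
  pullForm (GB z.1) (ContinuousLinearMap.fst ℝ E E')
    + f z.1 • pullForm (GF z.2) (ContinuousLinearMap.snd ℝ E E')

theorem coordWarped_apply (GB : E → E →L[ℝ] E →L[ℝ] ℝ) (f : E → ℝ)
    (GF : E' → E' →L[ℝ] E' →L[ℝ] ℝ) (z v w : E × E') :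
    coordWarped GB f GF z v w = GB z.1 v.1 w.1 + f z.1 * GF z.2 v.2 w.2 := rfl

/-- The local data of a warped product. -/
structure IsWarpedOn (GB : E → E →L[ℝ] E →L[ℝ] ℝ) (f : E → ℝ) (GF : E' → E' →L[ℝ] E' →L[ℝ] ℝ)
    (U : Set E) (V : Set E') : Prop where
  base : IsMetricOn GB U
  fiber : IsMetricOn GF V
  contDiffOn : ContDiffOn ℝ ∞ f U
  pos : ∀ x ∈ U, 0 < f x

namespace IsWarpedOn

variable {GB : E → E →L[ℝ] E →L[ℝ] ℝ} {f : E → ℝ} {GF : E' → E' →L[ℝ] E' →L[ℝ] ℝ}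
  {U : Set E} {V : Set E'} (h : IsWarpedOn GB f GF U V)
include h

theorem isOpen : IsOpen (U ×ˢ V) := h.base.isOpen.prod h.fiber.isOpen

theorem hasFDerivAt {x : E} (hx : x ∈ U) : HasFDerivAt f (fderiv ℝ f x) x :=
  (h.contDiffOn.differentiableAt_infty h.base.isOpen hx).hasFDerivAt

theorem hasFDerivAt_fderiv {x : E} (hx : x ∈ U) :
    HasFDerivAt (fderiv ℝ f) (fderiv ℝ (fderiv ℝ f) x) x :=
  ((h.contDiffOn.fderiv_infty h.base.isOpen).differentiableAt_infty h.base.isOpen hx).hasFDerivAt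

variable [FiniteDimensional ℝ E]

theorem coordGrad_spec {x : E} (hx : x ∈ U) (w : E) :
    GB x (coordGrad GB f x) w = fderiv ℝ f x w := by
  rw [coordGrad, (h.base.isInvertible hx).self_apply_inverse]

theorem contDiffOn_coordGrad : ContDiffOn ℝ ∞ (coordGrad GB f) U :=
  h.base.contDiffOn_inverse.clm_apply (h.contDiffOn.fderiv_infty h.base.isOpen)

theorem hasFDerivAt_coordGrad {x : E} (hx : x ∈ U) :
    HasFDerivAt (coordGrad GB f) (fderiv ℝ (coordGrad GB f) x) x :=
  (h.contDiffOn_coordGrad.differentiableAt_infty h.base.isOpen hx).hasFDerivAt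

omit [FiniteDimensional ℝ E] in
theorem coordHess_eq {x : E} (hx : x ∈ U) (u v : E) :
    coordHess GB f x u v
      = fderiv ℝ (fderiv ℝ f) x u v - fderiv ℝ f x (christoffelL GB x u v) := by
  have := ((h.hasFDerivAt_fderiv hx).clm_apply (hasFDerivAt_const u x)).fderiv
  rw [coordHess, this, h.base.christoffel_symm hx, christoffelL_apply,
    fderiv_fderiv_apply_comm h.contDiffOn h.base.isOpen hx u v]
  simp

omit [FiniteDimensional ℝ E] in
theorem coordT_eq {x : E} (hx : x ∈ U) (u v : E) :
    coordT GB f x u v = -(1 / (2 * f x)) *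
      (fderiv ℝ (fderiv ℝ f) x u v - fderiv ℝ f x (christoffelL GB x u v)
        - 1 / (2 * f x) * (fderiv ℝ f x u * fderiv ℝ f x v)) := by
  rw [coordT, h.coordHess_eq hx]

omit [FiniteDimensional ℝ E] in
theorem coordT_symm {x : E} (hx : x ∈ U) (u v : E) : coordT GB f x u v = coordT GB f x v u := by
  rw [h.coordT_eq hx, h.coordT_eq hx, christoffelL_apply, h.base.christoffel_symm hx,
    fderiv_fderiv_apply_comm h.contDiffOn h.base.isOpen hx, christoffelL_apply]
  ring

omit [FiniteDimensional ℝ E] in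
theorem coordT_smul_right {x : E} (hx : x ∈ U) (c : ℝ) (u v : E) :
    coordT GB f x u (c • v) = c * coordT GB f x u v := by
  rw [h.coordT_eq hx, h.coordT_eq hx]
  simp only [map_smul, smul_eq_mul]
  ring

omit [FiniteDimensional ℝ E] in
theorem coordT_zero_right {x : E} (hx : x ∈ U) (u : E) : coordT GB f x u 0 = 0 := by
  simpa using h.coordT_smul_right hx 0 u 0

omit [FiniteDimensional ℝ E] in
theorem coordT_zero_left {x : E} (hx : x ∈ U) (u : E) : coordT GB f x 0 u = 0 := by
  rw [h.coordT_symm hx, h.coordT_zero_right hx]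

theorem contDiffOn_coordT (u v : E) : ContDiffOn ℝ ∞ (fun x => coordT GB f x u v) U := by
  have hd := h.contDiffOn.fderiv_infty h.base.isOpen
  have h2 : ContDiffOn ℝ ∞ (fun x => 1 / (2 * f x)) U :=
    contDiffOn_const.div (contDiffOn_const.mul h.contDiffOn)
      fun x hx => by have := h.pos x hx; positivity
  refine ContDiffOn.congr ?_ fun x hx => h.coordT_eq hx u v
  exact h2.neg.mul (((((hd.fderiv_infty h.base.isOpen).clm_apply contDiffOn_const).clm_apply
    contDiffOn_const).sub (hd.clm_apply (h.base.contDiffOn_christoffel u v))).sub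
    (h2.mul ((hd.clm_apply contDiffOn_const).mul (hd.clm_apply contDiffOn_const))))

/-- The covariant derivative of the gradient is the Hessian. -/
theorem cov_coordGrad {x : E} (hx : x ∈ U) (m t : E) :
    GB x (fderiv ℝ (coordGrad GB f) x m + christoffelL GB x m (coordGrad GB f x)) t
      = coordHess GB f x m t := by
  have h1 := ((h.base.differentiableAt hx).hasFDerivAt.clm_apply
    (h.hasFDerivAt_coordGrad hx)).clm_apply (hasFDerivAt_const t x)
  have h2 := (h.hasFDerivAt_fderiv hx).clm_apply (hasFDerivAt_const t x)
  have h3 := h2.congr_of_eventuallyEq (f₁ := fun z => GB z (coordGrad GB f z) t)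
    (Filter.eventually_of_mem (h.base.isOpen.mem_nhds hx) fun z hz => h.coordGrad_spec hz t)
  have := congrArg (fun L => L m) (h1.unique h3)
  simp only [add_apply, ContinuousLinearMap.comp_apply,
    ContinuousLinearMap.flip_apply, zero_apply, map_zero, zero_add] at this
  rw [h.base.fderiv_eq_christoffelL hx, h.coordGrad_spec hx] at this
  rw [h.coordHess_eq hx, map_add, add_apply]
  linarith

omit [FiniteDimensional ℝ E] in
theorem hasFDerivAt_coordWarped {z : E × E'} (hz : z ∈ U ×ˢ V) (v w : E × E') :
    HasFDerivAt (fun z => coordWarped GB f GF z v w)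
      ((((fderiv ℝ GB z.1).flip v.1).flip w.1).comp (ContinuousLinearMap.fst ℝ E E')
        + (f z.1 • (((fderiv ℝ GF z.2).flip v.2).flip w.2).comp (ContinuousLinearMap.snd ℝ E E')
          + GF z.2 v.2 w.2 • (fderiv ℝ f z.1).comp (ContinuousLinearMap.fst ℝ E E'))) z := by
  have hB := (h.base.differentiableAt hz.1).hasFDerivAt
  have hF := (h.fiber.differentiableAt hz.2).hasFDerivAt
  have hB' := ((hB.clm_apply (hasFDerivAt_const v.1 z.1)).clm_apply
    (hasFDerivAt_const w.1 z.1)).comp z hasFDerivAt_fst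
  have hF' := ((hF.clm_apply (hasFDerivAt_const v.2 z.2)).clm_apply
    (hasFDerivAt_const w.2 z.2)).comp z hasFDerivAt_snd
  have := hB'.add (((h.hasFDerivAt hz.1).comp z hasFDerivAt_fst).mul hF')
  refine this.congr_fderiv ?_
  ext <;> simp

omit [FiniteDimensional ℝ E] in
theorem contDiffOn_coordWarped : ContDiffOn ℝ ∞ (coordWarped GB f GF) (U ×ˢ V) := by
  have hB : ContDiffOn ℝ ∞ (fun z : E × E' => GB z.1) (U ×ˢ V) :=
    h.base.contDiffOn.comp contDiff_fst.contDiffOn fun z hz => hz.1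
  have hF : ContDiffOn ℝ ∞ (fun z : E × E' => GF z.2) (U ×ˢ V) :=
    h.fiber.contDiffOn.comp contDiff_snd.contDiffOn fun z hz => hz.2
  have hf : ContDiffOn ℝ ∞ (fun z : E × E' => f z.1) (U ×ˢ V) :=
    h.contDiffOn.comp contDiff_fst.contDiffOn fun z hz => hz.1
  exact (contDiffOn_const.clm_comp (hB.clm_comp contDiffOn_const)).add
    (hf.smul (contDiffOn_const.clm_comp (hF.clm_comp contDiffOn_const)))

omit [FiniteDimensional ℝ E] in
theorem isMetricOn : IsMetricOn (coordWarped GB f GF) (U ×ˢ V) where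
  isOpen := h.isOpen
  contDiffOn := h.contDiffOn_coordWarped
  symm z hz v w := by
    rw [coordWarped_apply, coordWarped_apply, h.base.symm _ hz.1, h.fiber.symm _ hz.2]
  nondegenerate z hz v hv := by
    refine Prod.ext (h.base.nondegenerate _ hz.1 _ fun w => ?_)
      (h.fiber.nondegenerate _ hz.2 _ fun w => ?_)
    · simpa [coordWarped_apply] using hv (w, 0)
    · simpa [coordWarped_apply, (h.pos _ hz.1).ne'] using hv (0, w)

omit [FiniteDimensional ℝ E] in
theorem fderiv_coordWarped {z : E × E'} (hz : z ∈ U ×ˢ V) (m v w : E × E') :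
    fderiv ℝ (coordWarped GB f GF) z m v w = fderiv ℝ GB z.1 m.1 v.1 w.1
      + fderiv ℝ f z.1 m.1 * GF z.2 v.2 w.2 + f z.1 * fderiv ℝ GF z.2 m.2 v.2 w.2 := by
  have hd := (h.isMetricOn.differentiableAt hz).hasFDerivAt
  have h1 := (hd.clm_apply (hasFDerivAt_const v z)).clm_apply (hasFDerivAt_const w z)
  have := congrArg (fun L => L m) (h1.unique (h.hasFDerivAt_coordWarped hz v w))
  simp at this
  rw [this]
  ring

variable [FiniteDimensional ℝ E']

/-- Checked against the Koszul formula. Two fiber vectors acquire a component along grad f, while a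
base and a fiber vector produce a multiple of the fiber vector by half the logarithmic derivative of
f. -/
theorem christoffelL_coordWarped {z : E × E'} (hz : z ∈ U ×ˢ V) (u v : E × E') :
    christoffelL (coordWarped GB f GF) z u v
      = (christoffelL GB z.1 u.1 v.1 - ((1 / 2 : ℝ) * GF z.2 u.2 v.2) • coordGrad GB f z.1,
        christoffelL GF z.2 u.2 v.2 + (1 / (2 * f z.1) * fderiv ℝ f z.1 u.1) • v.2
          + (1 / (2 * f z.1) * fderiv ℝ f z.1 v.1) • u.2) := by
  have hf := (h.pos _ hz.1).ne'
  refine h.isMetricOn.christoffel_eq hz u v _ fun w => ?_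
  rw [coordWarped_apply, h.fderiv_coordWarped hz, h.fderiv_coordWarped hz,
    h.fderiv_coordWarped hz]
  simp only [map_sub, map_add, map_smul, sub_apply, add_apply, smul_apply, smul_eq_mul,
    christoffelL_apply, h.base.christoffel_spec hz.1, h.fiber.christoffel_spec hz.2,
    h.coordGrad_spec hz.1]
  field_simp
  ring

end IsWarpedOn

end WarpedCoordinates

/-! ### The curvature of a warped product. -/

section WarpedCurvature

set_option maxSynthPendingDepth 3

variable {E : Type*} [NormedAddCommGroup E] [NormedSpace ℝ E] [FiniteDimensional ℝ E]
  {E' : Type*} [NormedAddCommGroup E'] [NormedSpace ℝ E'] [FiniteDimensional ℝ E']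

namespace IsWarpedOn

variable {GB : E → E →L[ℝ] E →L[ℝ] ℝ} {f : E → ℝ} {GF : E' → E' →L[ℝ] E' →L[ℝ] ℝ}
  {U : Set E} {V : Set E'} (h : IsWarpedOn GB f GF U V)
include h

omit [FiniteDimensional ℝ E] [FiniteDimensional ℝ E'] in
theorem hasFDerivAt_half_log_deriv {x : E} (hx : x ∈ U) (u : E) :
    HasFDerivAt (fun x => 1 / (2 * f x) * fderiv ℝ f x u)
      ((1 / (2 * f x)) • (fderiv ℝ (fderiv ℝ f) x).flip u
        - (1 / (2 * f x ^ 2) * fderiv ℝ f x u) • fderiv ℝ f x) x := by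
  have hf := (h.pos _ hx).ne'
  have h1 := (h.hasFDerivAt hx).const_mul (2 : ℝ)
  have h2 := (hasDerivAt_inv (mul_ne_zero two_ne_zero hf)).comp_hasFDerivAt x h1
  have h3 := h2.mul ((h.hasFDerivAt_fderiv hx).clm_apply (hasFDerivAt_const u x))
  simp only [one_div]
  refine h3.congr_fderiv ?_
  ext m
  simp
  field_simp
  ring

theorem fderiv_christoffelL_coordWarped {z : E × E'} (hz : z ∈ U ×ˢ V) (m u v : E × E') :
    fderiv ℝ (christoffelL (coordWarped GB f GF)) z m u v
      = (fderiv ℝ (christoffelL GB) z.1 m.1 u.1 v.1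
          - ((1 / 2 : ℝ) * fderiv ℝ GF z.2 m.2 u.2 v.2) • coordGrad GB f z.1
          - ((1 / 2 : ℝ) * GF z.2 u.2 v.2) • fderiv ℝ (coordGrad GB f) z.1 m.1,
        fderiv ℝ (christoffelL GF) z.2 m.2 u.2 v.2
          + (1 / (2 * f z.1) * fderiv ℝ (fderiv ℝ f) z.1 m.1 u.1
              - 1 / (2 * f z.1 ^ 2) * fderiv ℝ f z.1 u.1 * fderiv ℝ f z.1 m.1) • v.2
          + (1 / (2 * f z.1) * fderiv ℝ (fderiv ℝ f) z.1 m.1 v.1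
              - 1 / (2 * f z.1 ^ 2) * fderiv ℝ f z.1 v.1 * fderiv ℝ f z.1 m.1) • u.2) := by
  have hW := (h.isMetricOn.contDiffOn_christoffelL.differentiableAt_infty
    h.isOpen hz).hasFDerivAt
  have h1 := (hW.clm_apply (hasFDerivAt_const u z)).clm_apply (hasFDerivAt_const v z)
  have hB := (((h.base.contDiffOn_christoffelL.differentiableAt_infty
    h.base.isOpen hz.1).hasFDerivAt.clm_apply (hasFDerivAt_const u.1 z.1)).clm_apply
    (hasFDerivAt_const v.1 z.1)).comp z hasFDerivAt_fst
  have hF := (((h.fiber.contDiffOn_christoffelL.differentiableAt_infty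
    h.fiber.isOpen hz.2).hasFDerivAt.clm_apply (hasFDerivAt_const u.2 z.2)).clm_apply
    (hasFDerivAt_const v.2 z.2)).comp z hasFDerivAt_snd
  have hG := (((((h.fiber.differentiableAt hz.2).hasFDerivAt.clm_apply
    (hasFDerivAt_const u.2 z.2)).clm_apply (hasFDerivAt_const v.2 z.2)).const_mul
    (1 / 2 : ℝ)).comp z hasFDerivAt_snd).smul
    ((h.hasFDerivAt_coordGrad hz.1).comp z hasFDerivAt_fst)
  have hu := ((h.hasFDerivAt_half_log_deriv hz.1 u.1).comp z hasFDerivAt_fst).smul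
    (hasFDerivAt_const v.2 z)
  have hv := ((h.hasFDerivAt_half_log_deriv hz.1 v.1).comp z hasFDerivAt_fst).smul
    (hasFDerivAt_const u.2 z)
  have h2 := (hB.sub hG).prodMk ((hF.add hu).add hv)
  have h3 := h2.congr_of_eventuallyEq
    (f₁ := fun z => christoffelL (coordWarped GB f GF) z u v)
    (Filter.eventually_of_mem (h.isOpen.mem_nhds hz)
      fun z hz => h.christoffelL_coordWarped hz u v)
  have := congrArg (fun L => L m) (h1.unique h3)
  simp at this
  rw [this]
  ext
  · simp
    module
  · simp

/-- The curvature tensor of a warped product. -/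
theorem riemL_coordWarped {z : E × E'} (hz : z ∈ U ×ˢ V) (u v w t : E × E') :
    riemL (coordWarped GB f GF) z u v w t
      = riemL GB z.1 u.1 v.1 w.1 t.1 + f z.1 * riemL GF z.2 u.2 v.2 w.2 t.2
        - f z.1 ^ 2 * coordP GB f z.1 * coordGauss GF z.2 u.2 v.2 w.2 t.2
        + f z.1 * (coordT GB f z.1 u.1 t.1 * GF z.2 v.2 w.2
          + coordT GB f z.1 v.1 w.1 * GF z.2 u.2 t.2
          - coordT GB f z.1 u.1 w.1 * GF z.2 v.2 t.2
          - coordT GB f z.1 v.1 t.1 * GF z.2 u.2 w.2) := by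
  have hf := (h.pos _ hz.1).ne'
  -- The ordinary derivative of the gradient is traded for the Hessian, which combines with the df ⊗
  -- df terms into T.
  have hN (m t : E) : GB z.1 (fderiv ℝ (coordGrad GB f) z.1 m) t
      = coordHess GB f z.1 m t - GB z.1 (christoffelL GB z.1 m (coordGrad GB f z.1)) t := by
    rw [← h.cov_coordGrad hz.1]
    simp
  have hs := h.fiber.symm _ hz.2
  have hc := fun a b => h.fiber.christoffel_symm hz.2 a b
  simp only [← christoffelL_apply] at hc
  have hff := fderiv_fderiv_apply_comm h.contDiffOn h.base.isOpen hz.1 u.1 v.1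
  rw [riemL_apply, riemL_apply, riemL_apply, curvOpL_apply, curvOpL_apply, curvOpL_apply,
    coordWarped_apply]
  simp only [← christoffelL_apply, h.christoffelL_coordWarped hz,
    h.fderiv_christoffelL_coordWarped hz, Prod.fst_add, Prod.snd_add, Prod.fst_sub,
    Prod.snd_sub, map_add, map_sub, map_smul, add_apply, sub_apply, smul_apply, smul_eq_mul, hN,
    h.coordGrad_spec hz.1, h.coordHess_eq hz.1, h.coordT_eq hz.1, coordP, coordGauss,
    h.fiber.fderiv_eq_christoffelL hz.2, hff, hc v.2 u.2,
    hs v.2 u.2, hs (christoffelL GF z.2 u.2 v.2) w.2]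
  field_simp
  ring

end IsWarpedOn

end WarpedCurvature

/-! ### Components of ∇R for a warped product. -/

section WarpedCovariantDerivative

set_option maxSynthPendingDepth 3

variable {E : Type*} [NormedAddCommGroup E] [NormedSpace ℝ E] [FiniteDimensional ℝ E]
  {E' : Type*} [NormedAddCommGroup E'] [NormedSpace ℝ E'] [FiniteDimensional ℝ E']

/-- On fixed vectors the component of R is an explicit function ψ, so only ψ has to be
differentiated; the four corrections remain algebraic. -/
theorem IsMetricOn.coordCov4_of_riemL_eq {G : E → E →L[ℝ] E →L[ℝ] ℝ} {U : Set E}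
    (h : IsMetricOn G U) {u v w t : E} {ψ : E → ℝ} (hψ : ∀ y ∈ U, riemL G y u v w t = ψ y)
    {y : E} (hy : y ∈ U) {ψ' : E →L[ℝ] ℝ} (hψ' : HasFDerivAt ψ ψ' y) (m : E) :
    coordCov4 G (coordRiem G) y m u v w t = ψ' m
      - riemL G y (christoffelL G y m u) v w t - riemL G y u (christoffelL G y m v) w t
      - riemL G y u v (christoffelL G y m w) t - riemL G y u v w (christoffelL G y m t) := by
  have h1 : fderiv ℝ (fun z => coordRiem G z u v w t) y = ψ' :=
    (hψ'.congr_of_eventuallyEq (Filter.eventually_of_mem (h.isOpen.mem_nhds hy)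
      fun z hz => (h.coordRiem_eq hz u v w t).trans (hψ z hz))).fderiv
  rw [coordCov4, h1]
  simp only [h.coordRiem_eq hy, christoffelL_apply]

theorem IsMetricOn.hasFDerivAt_riemL_apply {G : E → E →L[ℝ] E →L[ℝ] ℝ} {U : Set E}
    (h : IsMetricOn G U) {y : E} (hy : y ∈ U) (u v w t : E) :
    HasFDerivAt (fun y => riemL G y u v w t)
      ((((fderiv ℝ (riemL G) y).flip u).flip v |>.flip w).flip t) y := by
  have hd := (h.contDiffOn_riemL.differentiableAt_infty h.isOpen hy).hasFDerivAt
  have c (a : E) := hasFDerivAt_const (𝕜 := ℝ) a y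
  refine ((((hd.clm_apply (c u)).clm_apply (c v)).clm_apply (c w)).clm_apply
    (c t)).congr_fderiv ?_
  ext m
  simp

omit [FiniteDimensional ℝ E] in
theorem IsMetricOn.hasFDerivAt_apply {G : E → E →L[ℝ] E →L[ℝ] ℝ} {U : Set E}
    (h : IsMetricOn G U) {y : E} (hy : y ∈ U) (u v : E) :
    HasFDerivAt (fun y => G y u v) (((fderiv ℝ G y).flip u).flip v) y := by
  have c (a : E) := hasFDerivAt_const (𝕜 := ℝ) a y
  refine (((h.differentiableAt hy).hasFDerivAt.clm_apply (c u)).clm_apply (c v)).congr_fderiv ?_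
  ext m
  simp

namespace IsWarpedOn

variable {GB : E → E →L[ℝ] E →L[ℝ] ℝ} {f : E → ℝ} {GF : E' → E' →L[ℝ] E' →L[ℝ] ℝ}
  {U : Set E} {V : Set E'} (h : IsWarpedOn GB f GF U V)
include h

omit [FiniteDimensional ℝ E'] in
theorem hasFDerivAt_coordT {x : E} (hx : x ∈ U) (u v : E) :
    HasFDerivAt (fun x => coordT GB f x u v) (fderiv ℝ (fun x => coordT GB f x u v) x) x :=
  ((h.contDiffOn_coordT u v).differentiableAt_infty h.base.isOpen hx).hasFDerivAt

omit [FiniteDimensional ℝ E'] in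
theorem contDiffOn_sq_mul_coordP : ContDiffOn ℝ ∞ (fun x => f x ^ 2 * coordP GB f x) U := by
  have h1 : ContDiffOn ℝ ∞ (fun x => 1 / (4 * f x ^ 2)) U :=
    contDiffOn_const.div (contDiffOn_const.mul (h.contDiffOn.pow 2))
      fun x hx => by have := h.pos x hx; positivity
  exact (h.contDiffOn.pow 2).mul (h1.mul
    ((h.contDiffOn.fderiv_infty h.base.isOpen).clm_apply h.contDiffOn_coordGrad))

/-- The Christoffel corrections of base vectors may have fiber parts, but R vanishes on three base
vectors and one fiber vector. The fiber part of m therefore does not contribute. -/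
theorem cov_base (m : E × E') (u v w t : E) {z : E × E'} (hz : z ∈ U ×ˢ V) :
    coordCov4 (coordWarped GB f GF) (coordRiem (coordWarped GB f GF)) z m
      (u, 0) (v, 0) (w, 0) (t, 0) = coordCov4 GB (coordRiem GB) z.1 m.1 u v w t := by
  rw [h.isMetricOn.coordCov4_of_riemL_eq (ψ := fun z => riemL GB z.1 u v w t)
    (fun y hy => by simp [h.riemL_coordWarped hy, coordGauss]) hz
    ((h.base.hasFDerivAt_riemL_apply hz.1 u v w t).comp z hasFDerivAt_fst) m,
    h.base.coordCov4_coordRiem hz.1]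
  simp [h.riemL_coordWarped hz, h.christoffelL_coordWarped hz, coordGauss, christoffelL_apply]

/-- The component of R is f T(u,t) g̃(b,c). The derivative of f cancels against the df/(2f)
corrections in the two fiber slots, and that of g̃ against the fiber connection. -/
theorem cov_mixed (m : E × E') (u t : E) (b c : E') {z : E × E'} (hz : z ∈ U ×ˢ V) :
    coordCov4 (coordWarped GB f GF) (coordRiem (coordWarped GB f GF)) z m
      (u, 0) (0, b) (0, c) (t, 0)
      = f z.1 * coordCov2 GB (coordT GB f) z.1 m.1 u t * GF z.2 b c := by
  have hf := (h.pos _ hz.1).ne'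
  rw [h.isMetricOn.coordCov4_of_riemL_eq
    (ψ := fun z => f z.1 * (coordT GB f z.1 u t * GF z.2 b c))
    (fun y hy => by simp [h.riemL_coordWarped hy, coordGauss, h.coordT_zero_left hy.1,
      h.coordT_zero_right hy.1]) hz
    (((h.hasFDerivAt hz.1).comp z hasFDerivAt_fst).mul
      (((h.hasFDerivAt_coordT hz.1 u t).comp z hasFDerivAt_fst).mul
        ((h.fiber.hasFDerivAt_apply hz.2 b c).comp z hasFDerivAt_snd))) m]
  simp [h.riemL_coordWarped hz, h.christoffelL_coordWarped hz, coordGauss,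
    h.coordT_zero_left hz.1, h.coordT_zero_right hz.1, coordCov2,
    h.fiber.fderiv_eq_christoffelL hz.2, ← christoffelL_apply]
  field_simp
  ring

/-- In a fiber direction f and P are constant and g̃ is parallel, so the Gauss term contributes
nothing. The grad f parts of the corrections meet components of R with one base vector, which are
zero. -/
theorem cov_fiber (e a b c d : E') {z : E × E'} (hz : z ∈ U ×ˢ V) :
    coordCov4 (coordWarped GB f GF) (coordRiem (coordWarped GB f GF)) z (0, e)
      (0, a) (0, b) (0, c) (0, d) = f z.1 * coordCov4 GF (coordRiem GF) z.2 e a b c d := by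
  have k := ((h.contDiffOn_sq_mul_coordP.differentiableAt_infty
    h.base.isOpen hz.1).hasFDerivAt).comp z hasFDerivAt_fst
  have g (v w : E') := (h.fiber.hasFDerivAt_apply hz.2 v w).comp z hasFDerivAt_snd
  rw [h.isMetricOn.coordCov4_of_riemL_eq
    (ψ := fun z => f z.1 * riemL GF z.2 a b c d
      - f z.1 ^ 2 * coordP GB f z.1 * (GF z.2 a d * GF z.2 b c - GF z.2 a c * GF z.2 b d))
    (fun y hy => by simp [h.riemL_coordWarped hy, h.coordT_zero_left hy.1, coordGauss]) hz
    ((((h.hasFDerivAt hz.1).comp z hasFDerivAt_fst).mul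
      ((h.fiber.hasFDerivAt_riemL_apply hz.2 a b c d).comp z hasFDerivAt_snd)).sub
      (k.mul (((g a d).mul (g b c)).sub ((g a c).mul (g b d))))) (0, e),
    h.fiber.coordCov4_coordRiem hz.2]
  simp [h.riemL_coordWarped hz, h.christoffelL_coordWarped hz, coordGauss,
    h.coordT_zero_left hz.1, h.coordT_zero_right hz.1, h.fiber.fderiv_eq_christoffelL hz.2,
    ← christoffelL_apply]
  ring

/-- With f locally constant, P vanishes and the fiber component of R does not vary along the base;
the corrections vanish too. -/
theorem cov_fiber_of_fderiv_eq_zero (hf0 : ∀ x ∈ U, fderiv ℝ f x = 0) (m : E) (a b c d : E')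
    {z : E × E'} (hz : z ∈ U ×ˢ V) :
    coordCov4 (coordWarped GB f GF) (coordRiem (coordWarped GB f GF)) z (m, 0)
      (0, a) (0, b) (0, c) (0, d) = 0 := by
  rw [h.isMetricOn.coordCov4_of_riemL_eq
    (ψ := fun z => f z.1 * riemL GF z.2 a b c d)
    (fun y hy => by simp [h.riemL_coordWarped hy, h.coordT_zero_left hy.1, coordP, hf0 _ hy.1]) hz
    (((h.hasFDerivAt hz.1).comp z hasFDerivAt_fst).mul
      ((h.fiber.hasFDerivAt_riemL_apply hz.2 a b c d).comp z hasFDerivAt_snd)) (m, 0)]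
  simp [h.riemL_coordWarped hz, h.christoffelL_coordWarped hz, coordGauss,
    h.coordT_zero_left hz.1, hf0 _ hz.1]

/-- The component of R is identically zero, so only corrections survive. The slot of u turns into a
multiple of e and yields the fiber curvature; the last two slots turn into multiples of grad f and
yield T(u, grad f). -/
theorem cov_base_fiber (e : E') (u : E) (b c d : E') {z : E × E'} (hz : z ∈ U ×ˢ V) :
    coordCov4 (coordWarped GB f GF) (coordRiem (coordWarped GB f GF)) z (0, e)
      (u, 0) (0, b) (0, c) (0, d)
      = 1 / 2 * f z.1 * coordT GB f z.1 u (coordGrad GB f z.1) * coordGauss GF z.2 e b c d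
        - 1 / 2 * fderiv ℝ f z.1 u * (coordRiem GF z.2 e b c d
          - f z.1 * coordP GB f z.1 * coordGauss GF z.2 e b c d) := by
  have hf := (h.pos _ hz.1).ne'
  rw [h.isMetricOn.coordCov4_of_riemL_eq (ψ := fun z => 0)
    (fun y hy => by simp [h.riemL_coordWarped hy, coordGauss, h.coordT_zero_left hy.1,
      h.coordT_zero_right hy.1]) hz (hasFDerivAt_const 0 z) (0, e),
    h.fiber.coordRiem_eq hz.2]
  simp [h.riemL_coordWarped hz, h.christoffelL_coordWarped hz, coordGauss,
    h.coordT_zero_left hz.1, h.coordT_zero_right hz.1, ← neg_smul, h.coordT_smul_right hz.1]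
  field_simp
  ring

end IsWarpedOn

end WarpedCovariantDerivative

/-! ### Smooth tensor fields read in the preferred charts. -/

section ChartTensors

set_option maxSynthPendingDepth 3

variable {E : Type*} [NormedAddCommGroup E] [NormedSpace ℝ E]
  {H : Type*} [TopologicalSpace H] {I : ModelWithCorners ℝ E H} [I.Boundaryless]
  {M : Type*} [TopologicalSpace M] [ChartedSpace H M] [IsManifold I ∞ M]

/-- A 1-form written in the preferred chart at `x`. -/
def chartForm (θ : ∀ x : M, TangentSpace I x →L[ℝ] ℝ) (x : M) (y : E) : E →L[ℝ] ℝ :=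
  (θ ((extChartAt I x).symm y)).comp (mfderiv 𝓘(ℝ, E) I (extChartAt I x).symm y)

theorem symmL_trivializationAt_eq {x y : M} (hy : y ∈ (chartAt H x).source) :
    (trivializationAt E (TangentSpace I) x).symmL ℝ y
      = mfderiv 𝓘(ℝ, E) I (extChartAt I x).symm (extChartAt I x y) := by
  rw [TangentBundle.symmL_trivializationAt hy, I.range_eq_univ, mfderivWithin_univ]

/-- The tangent space at x is identified with the model space through this very chart, so tensors at
x agree with their chart expressions at the image of x. -/
theorem mfderiv_extChartAt_symm_self (x : M) :
    mfderiv 𝓘(ℝ, E) I (extChartAt I x).symm (extChartAt I x x) = ContinuousLinearMap.id ℝ E := by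
  have := mfderivWithin_range_extChartAt_symm (I := I) (x := x)
  rwa [I.range_eq_univ, mfderivWithin_univ] at this

theorem mdifferentiableAt_extChartAt_symm {x : M} {y : E} (hy : y ∈ (extChartAt I x).target) :
    MDifferentiableAt 𝓘(ℝ, E) I (extChartAt I x).symm y := by
  have := mdifferentiableWithinAt_extChartAt_symm (I := I) hy
  rwa [I.range_eq_univ, mdifferentiableWithinAt_univ] at this

theorem isInvertible_mfderiv_extChartAt_symm {x : M} {y : E}
    (hy : y ∈ (extChartAt I x).target) :
    (mfderiv 𝓘(ℝ, E) I (extChartAt I x).symm y).IsInvertible := by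
  have := isInvertible_mfderivWithin_extChartAt_symm (I := I) hy
  rwa [I.range_eq_univ, mfderivWithin_univ] at this

theorem symmL_trivializationAt_apply {x : M} {y : E} (hy : y ∈ (extChartAt I x).target) (v : E) :
    (trivializationAt E (TangentSpace I) x).symmL ℝ ((extChartAt I x).symm y) v
      = mfderiv 𝓘(ℝ, E) I (extChartAt I x).symm y v := by
  have hy' : (extChartAt I x).symm y ∈ (chartAt H x).source := by
    rw [← extChartAt_source (I := I)]
    exact (extChartAt I x).map_target hy
  have := congrArg (fun L => L v) (symmL_trivializationAt_eq (I := I) hy')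
  rwa [(extChartAt I x).right_inv hy] at this

theorem trivializationAt_symm_apply {x : M} {y : E} (hy : y ∈ (extChartAt I x).target) (v : E) :
    (trivializationAt E (TangentSpace I) x).symm ((extChartAt I x).symm y) v
      = mfderiv 𝓘(ℝ, E) I (extChartAt I x).symm y v := by
  have hy' : (extChartAt I x).symm y ∈ (chartAt H x).source := by
    rw [← extChartAt_source (I := I)]
    exact (extChartAt I x).map_target hy
  exact ((trivializationAt E (TangentSpace I) x).symmL_apply
    (by simpa using hy') v).symm.trans (symmL_trivializationAt_apply hy v)

omit [I.Boundaryless] in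
/-- Smoothness on a chart domain can be tested in the chart. -/
theorem contMDiffOn_source_iff {W : Type*} [NormedAddCommGroup W] [NormedSpace ℝ W]
    (k : M → W) (x : M) :
    ContMDiffOn I 𝓘(ℝ, W) ∞ k (chartAt H x).source
      ↔ ContDiffOn ℝ ∞ (k ∘ (extChartAt I x).symm) (extChartAt I x).target := by
  rw [← contMDiffOn_iff_contDiffOn]
  constructor
  · intro hk
    exact hk.comp (contMDiffOn_extChartAt_symm x) fun y hy => by
      simpa only [extChartAt_source, Set.mem_preimage] using (extChartAt I x).map_target hy
  · intro hk
    have h2 : ContMDiffOn I 𝓘(ℝ, E) ∞ (extChartAt I x) (chartAt H x).source :=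
      contMDiffOn_extChartAt
    refine (hk.comp h2 fun y hy => (extChartAt I x).map_source (by rwa [extChartAt_source])).congr
      fun y hy => ?_
    simp only [Function.comp_apply]
    rw [(extChartAt I x).left_inv (by rwa [extChartAt_source])]

/-- In the trivialization at x the section becomes `chartForm`, because the inverse trivialization
is the derivative of the inverse chart. Smoothness is local, so the chart domains suffice. -/
theorem isSmoothOneForm_iff (θ : ∀ x : M, TangentSpace I x →L[ℝ] ℝ) :
    IsSmoothOneForm I θ
      ↔ ∀ x, ContDiffOn ℝ ∞ (chartForm θ x) (extChartAt I x).target := by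
  have key (x : M) : ContMDiffOn I (I.prod 𝓘(ℝ, E →L[ℝ] ℝ)) ∞
      (fun x => Bundle.TotalSpace.mk' (E →L[ℝ] ℝ) (E := fun x : M => TangentSpace I x →L[ℝ] ℝ)
        x (θ x)) (chartAt H x).source
      ↔ ContDiffOn ℝ ∞ (chartForm θ x) (extChartAt I x).target := by
    have hb : (trivializationAt (E →L[ℝ] ℝ) (fun x : M => TangentSpace I x →L[ℝ] ℝ) x).baseSet
        = (chartAt H x).source := by
      simp [hom_trivializationAt_baseSet]
    rw [← hb, Bundle.Trivialization.contMDiffOn_section_baseSet_iff, hb, contMDiffOn_source_iff]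
    refine contDiffOn_congr fun y hy => ?_
    ext v
    simp only [Function.comp_apply, hom_trivializationAt_apply, ContinuousLinearMap.inCoordinates,
      Bundle.Trivial.fiberBundle_trivializationAt',
      Bundle.Trivial.continuousLinearMapAt_trivialization]
    exact congrArg (θ _) (symmL_trivializationAt_apply hy v)
  constructor
  · intro h x
    exact (key x).1 h.contMDiffOn
  · intro h x
    exact ((key x).2 (h x)).contMDiffAt ((chartAt H x).open_source.mem_nhds (mem_chart_source H x))

theorem IsSemiRiemannianMetric.contDiffOn_chartMetric
    {g : ∀ x : M, TangentSpace I x →L[ℝ] TangentSpace I x →L[ℝ] ℝ}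
    (hg : IsSemiRiemannianMetric I g) (x : M) :
    ContDiffOn ℝ ∞ (chartMetric g x) (extChartAt I x).target := by
  have hb : (trivializationAt (E →L[ℝ] E →L[ℝ] ℝ)
      (fun x : M => TangentSpace I x →L[ℝ] TangentSpace I x →L[ℝ] ℝ) x).baseSet
        = (chartAt H x).source := by
    simp [hom_trivializationAt_baseSet]
  have hs := hg.smooth.contMDiffOn (s := (chartAt H x).source)
  rw [← hb, Bundle.Trivialization.contMDiffOn_section_baseSet_iff, hb,
    contMDiffOn_source_iff] at hs
  refine hs.congr fun y hy => ?_
  have hy' : (extChartAt I x).symm y ∈ (chartAt H x).source := by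
    rw [← extChartAt_source (I := I)]
    exact (extChartAt I x).map_target hy
  ext v w
  simp only [Function.comp_apply, hom_trivializationAt_apply]
  rw [inCoordinates_apply_eq₂ (by simpa using hy') (by simpa using hy')
    (by simp)]
  simp only [Bundle.Trivial.fiberBundle_trivializationAt',
    Bundle.Trivial.linearMapAt_trivialization, LinearMap.id_coe, id_eq]
  rw [trivializationAt_symm_apply hy, trivializationAt_symm_apply hy]
  rfl

end ChartTensors

/-! ### Change of charts, and nowhere vanishing curvature. -/

section ChartTransition

set_option maxSynthPendingDepth 3

variable {E : Type*} [NormedAddCommGroup E] [NormedSpace ℝ E]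
  {H : Type*} [TopologicalSpace H] {I : ModelWithCorners ℝ E H} [I.Boundaryless]
  {M : Type*} [TopologicalSpace M] [ChartedSpace H M] [IsManifold I ∞ M]
  {g : ∀ x : M, TangentSpace I x →L[ℝ] TangentSpace I x →L[ℝ] ℝ}

-- The type of `g p` depends on p, so base points cannot be rewritten directly; taking v and w in
-- the model space E makes both sides well typed.
omit [I.Boundaryless] [IsManifold I ∞ M] in
theorem form_congr (g : ∀ x : M, TangentSpace I x →L[ℝ] TangentSpace I x →L[ℝ] ℝ) {p q : M}
    (hpq : p = q) (v w : E) : g p v w = g q v w := by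
  subst hpq
  rfl

omit [I.Boundaryless] [IsManifold I ∞ M] in
theorem oneForm_congr (θ : ∀ x : M, TangentSpace I x →L[ℝ] ℝ) {p q : M}
    (hpq : p = q) (v : E) : θ p v = θ q v := by
  subst hpq
  rfl

omit [I.Boundaryless] [IsManifold I ∞ M] in
theorem chartMetric_apply (x : M) (y v w : E) : chartMetric g x y v w
    = g ((extChartAt I x).symm y) (mfderiv 𝓘(ℝ, E) I (extChartAt I x).symm y v)
        (mfderiv 𝓘(ℝ, E) I (extChartAt I x).symm y w) := rfl

theorem chartMetric_self (x : M) : chartMetric g x (extChartAt I x x) = g x := by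
  ext v w
  rw [chartMetric_apply, mfderiv_extChartAt_symm_self]
  exact form_congr g (extChartAt_to_inv x) v w

theorem IsSemiRiemannianMetric.isMetricOn_chartMetric (hg : IsSemiRiemannianMetric I g) (x : M) :
    IsMetricOn (chartMetric g x) (extChartAt I x).target where
  isOpen := isOpen_extChartAt_target x
  contDiffOn := hg.contDiffOn_chartMetric x
  symm y _ v w := hg.symm _ _ _
  nondegenerate y hy v hv := by
    have hA := isInvertible_mfderiv_extChartAt_symm (I := I) hy
    refine hA.injective ((hg.nondegenerate _ _ fun w => ?_).trans (map_zero _).symm)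
    obtain ⟨w, rfl⟩ := hA.surjective w
    exact hv w

/-- The coordinate change from the preferred chart at `z` to the one at `z'`. -/
def chartChange (I : ModelWithCorners ℝ E H) (z z' : M) : E → E :=
  extChartAt I z' ∘ (extChartAt I z).symm

/-- The domain of the coordinate change from the chart at `z` to the one at `z'`. -/
def chartOverlap (I : ModelWithCorners ℝ E H) (z z' : M) : Set E :=
  (extChartAt I z).target ∩ (extChartAt I z).symm ⁻¹' (extChartAt I z').source

omit [IsManifold I ∞ M] in
theorem isOpen_chartOverlap (z z' : M) : IsOpen (chartOverlap I z z') :=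
  (continuousOn_extChartAt_symm z).isOpen_inter_preimage (isOpen_extChartAt_target z)
    (isOpen_extChartAt_source z')

omit [I.Boundaryless] in
theorem contDiffOn_chartChange (z z' : M) :
    ContDiffOn ℝ ∞ (chartChange I z z') (chartOverlap I z z') := by
  rw [← contMDiffOn_iff_contDiffOn]
  have h2 : ContMDiffOn I 𝓘(ℝ, E) ∞ (extChartAt I z') (chartAt H z').source :=
    contMDiffOn_extChartAt
  refine h2.comp ((contMDiffOn_extChartAt_symm z).mono Set.inter_subset_left) fun y hy => ?_
  rw [Set.mem_preimage, ← extChartAt_source (I := I)]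
  exact hy.2

theorem mfderiv_fderiv_chartChange (z z' : M) {y : E} (hy : y ∈ chartOverlap I z z') (v : E) :
    mfderiv 𝓘(ℝ, E) I (extChartAt I z).symm y v
      = mfderiv 𝓘(ℝ, E) I (extChartAt I z').symm (chartChange I z z' y)
          (fderiv ℝ (chartChange I z z') y v) := by
  have hd : DifferentiableAt ℝ (chartChange I z z') y :=
    (contDiffOn_chartChange z z').differentiableAt_infty (isOpen_chartOverlap z z') hy
  have hmem : chartChange I z z' y ∈ (extChartAt I z').target := (extChartAt I z').map_source hy.2
  have h1 := mfderiv_comp y (mdifferentiableAt_extChartAt_symm hmem) hd.mdifferentiableAt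
  have h2 : (extChartAt I z).symm =ᶠ[nhds y] (extChartAt I z').symm ∘ chartChange I z z' :=
    Filter.eventually_of_mem ((isOpen_chartOverlap z z').mem_nhds hy)
      fun a ha => ((extChartAt I z').left_inv ha.2).symm
  have h3 : mfderiv 𝓘(ℝ, E) I (extChartAt I z).symm y
      = mfderiv 𝓘(ℝ, E) I ((extChartAt I z').symm ∘ chartChange I z z') y := h2.mfderiv_eq
  rw [h1, mfderiv_eq_fderiv] at h3
  exact congrArg (fun L : E →L[ℝ] E => L v) h3

/-- Both chart metrics are pull-backs of the same g, so the chain rule makes the coordinate change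
an isometry. -/
theorem isIsometryOn_chartChange (hg : ∀ x, IsMetricOn (chartMetric g x) (extChartAt I x).target)
    (z z' : M) : IsIsometryOn (chartMetric g z) (chartMetric g z') (chartOverlap I z z')
      (extChartAt I z').target (chartChange I z z') where
  source := (hg z).mono (isOpen_chartOverlap z z') Set.inter_subset_left
  target := hg z'
  contDiffOn := contDiffOn_chartChange z z'
  mapsTo y hy := (extChartAt I z').map_source hy.2
  pullback y hy v w := by
    rw [chartMetric_apply, chartMetric_apply, mfderiv_fderiv_chartChange z z' hy,
      mfderiv_fderiv_chartChange z z' hy]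
    exact form_congr g ((extChartAt I z').left_inv hy.2).symm _ _

omit [I.Boundaryless] [IsManifold I ∞ M] in
theorem extChartAt_mem_chartOverlap {z z' : M} (hz' : z' ∈ (extChartAt I z).source) :
    extChartAt I z z' ∈ chartOverlap I z z' := by
  refine ⟨(extChartAt I z).map_source hz', ?_⟩
  rw [Set.mem_preimage, (extChartAt I z).left_inv hz']
  exact mem_extChartAt_source z'

omit [I.Boundaryless] [IsManifold I ∞ M] in
theorem chartChange_extChartAt {z z' : M} (hz' : z' ∈ (extChartAt I z).source) :
    chartChange I z z' (extChartAt I z z') = extChartAt I z' z' := by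
  rw [chartChange, Function.comp_apply, (extChartAt I z).left_inv hz']

theorem chartForm_extChartAt (θ : ∀ x : M, TangentSpace I x →L[ℝ] ℝ) {z z' : M}
    (hz' : z' ∈ (extChartAt I z).source) (m : E) :
    chartForm θ z (extChartAt I z z') m
      = θ z' (fderiv ℝ (chartChange I z z') (extChartAt I z z') m) := by
  have h1 := mfderiv_fderiv_chartChange z z' (extChartAt_mem_chartOverlap hz') m
  rw [chartChange_extChartAt hz', mfderiv_extChartAt_symm_self] at h1
  rw [chartForm]
  refine (congrArg (θ _) h1).trans ?_
  exact oneForm_congr θ ((extChartAt I z).left_inv hz') _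

variable [FiniteDimensional ℝ E]

/-- `riem g z'` is computed in the chart preferred at z'. This expresses it in the fixed chart at z,
where nearby points can be compared. -/
theorem coordRiem_extChartAt (hg : ∀ x, IsMetricOn (chartMetric g x) (extChartAt I x).target)
    {z z' : M} (hz' : z' ∈ (extChartAt I z).source) (u v w t : E) :
    coordRiem (chartMetric g z) (extChartAt I z z') u v w t
      = riem g z' (fderiv ℝ (chartChange I z z') (extChartAt I z z') u)
        (fderiv ℝ (chartChange I z z') (extChartAt I z z') v)
        (fderiv ℝ (chartChange I z z') (extChartAt I z z') w)
        (fderiv ℝ (chartChange I z z') (extChartAt I z z') t) := by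
  rw [(isIsometryOn_chartChange hg z z').coordRiem_eq (extChartAt_mem_chartOverlap hz'),
    chartChange_extChartAt hz']
  rfl

theorem coordCov4_extChartAt (hg : ∀ x, IsMetricOn (chartMetric g x) (extChartAt I x).target)
    {z z' : M} (hz' : z' ∈ (extChartAt I z).source) (m u v w t : E) :
    coordCov4 (chartMetric g z) (coordRiem (chartMetric g z)) (extChartAt I z z') m u v w t
      = covRiem g z' (fderiv ℝ (chartChange I z z') (extChartAt I z z') m)
        (fderiv ℝ (chartChange I z z') (extChartAt I z z') u)
        (fderiv ℝ (chartChange I z z') (extChartAt I z z') v)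
        (fderiv ℝ (chartChange I z z') (extChartAt I z z') w)
        (fderiv ℝ (chartChange I z z') (extChartAt I z z') t) := by
  rw [(isIsometryOn_chartChange hg z z').coordCov4_eq (extChartAt_mem_chartOverlap hz'),
    chartChange_extChartAt hz']
  rfl

theorem riem_eq_zero_iff (hg : ∀ x, IsMetricOn (chartMetric g x) (extChartAt I x).target)
    {z z' : M} (hz' : z' ∈ (extChartAt I z).source) :
    (∀ u v w t, riem g z' u v w t = 0)
      ↔ ∀ u v w t, coordRiem (chartMetric g z) (extChartAt I z z') u v w t = 0 := by
  simp only [coordRiem_extChartAt hg hz']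
  refine ⟨fun h u v w t => h _ _ _ _, fun h u v w t => ?_⟩
  have hs := (isIsometryOn_chartChange hg z z').surjective (extChartAt_mem_chartOverlap hz')
  obtain ⟨u, rfl⟩ := hs u
  obtain ⟨v, rfl⟩ := hs v
  obtain ⟨w, rfl⟩ := hs w
  obtain ⟨t, rfl⟩ := hs t
  exact h u v w t

/-- If `∇R = θ ⊗ R` on a connected manifold and `R` does not vanish identically, then `R` vanishes
nowhere. -/
theorem riem_ne_zero_of_recurrent [PreconnectedSpace M]
    (hg : ∀ x, IsMetricOn (chartMetric g x) (extChartAt I x).target)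
    {θ : ∀ x : M, TangentSpace I x →L[ℝ] ℝ} (hθ : IsSmoothOneForm I θ)
    (hrec : ∀ z m u v w t, covRiem g z m u v w t = θ z m * riem g z u v w t)
    (hR : ∃ z, ∃ u v w t, riem g z u v w t ≠ 0) (z : M) : ∃ u v w t, riem g z u v w t ≠ 0 := by
  set Z : Set M := {z | ∀ u v w t, riem g z u v w t = 0} with hZ
  have near (z : M) : ∀ᶠ z' in nhds z, z' ∈ (extChartAt I z).source :=
    extChartAt_source_mem_nhds z
  -- Openness is the uniqueness statement for the linear equation ∇R = θ ⊗ R, after carrying the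
  -- recurrence to the fixed chart at z.
  have hopen : IsOpen Z := by
    refine isOpen_iff_mem_nhds.2 fun z hz => ?_
    have hrec' : ∀ᶠ y in nhds (extChartAt I z z), ∀ m u v w t,
        coordCov4 (chartMetric g z) (coordRiem (chartMetric g z)) y m u v w t
          = chartForm θ z y m * coordRiem (chartMetric g z) y u v w t := by
      filter_upwards [extChartAt_target_mem_nhds (I := I) z] with y hy m u v w t
      have hs := (extChartAt I z).map_target hy
      rw [← (extChartAt I z).right_inv hy, coordCov4_extChartAt hg hs, coordRiem_extChartAt hg hs,
        chartForm_extChartAt θ hs]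
      exact hrec _ _ _ _ _ _
    have := (hg z).eventually_coordRiem_eq_zero (mem_extChartAt_target z)
      (((isSmoothOneForm_iff θ).1 hθ z).differentiableAt_infty (isOpen_extChartAt_target z)
        (mem_extChartAt_target z)).continuousAt hrec' hz
    filter_upwards [(continuousAt_extChartAt z).eventually this, near z] with z' h1 h2
    exact (riem_eq_zero_iff hg h2).2 h1
  -- Closedness is continuity of R in the fixed chart at z.
  have hclosed : IsClosed Z := by
    refine isOpen_compl_iff.1 (isOpen_iff_mem_nhds.2 fun z hz => ?_)
    have hz' : riemL (chartMetric g z) (extChartAt I z z) ≠ 0 := fun h0 => hz fun u v w t => by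
      refine ((hg z).coordRiem_eq (mem_extChartAt_target z) u v w t).trans ?_
      rw [h0]
      rfl
    have hc : ContinuousAt (riemL (chartMetric g z)) (extChartAt I z z) :=
      ((hg z).contDiffOn_riemL.differentiableAt_infty (isOpen_extChartAt_target z)
        (mem_extChartAt_target z)).continuousAt
    filter_upwards [(continuousAt_extChartAt z).eventually (hc.eventually_ne hz'), near z]
      with z' h1 h2 h3
    refine h1 ?_
    ext u v w t
    rw [← (hg z).coordRiem_eq ((extChartAt I z).map_source h2)]
    exact (riem_eq_zero_iff hg h2).1 h3 u v w t
  rcases isClopen_iff.1 ⟨hclosed, hopen⟩ with h | h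
  · have : z ∉ Z := h ▸ Set.notMem_empty z
    simpa [hZ] using this
  · obtain ⟨z₀, u, v, w, t, h0⟩ := hR
    exact absurd ((h ▸ Set.mem_univ z₀ : z₀ ∈ Z) u v w t) h0

end ChartTransition

/-! ### Consequences of ∇R = α ⊗ R at one point of a warped product. -/

section RecurrentWarped

set_option maxSynthPendingDepth 3

variable {E : Type*} [NormedAddCommGroup E] [NormedSpace ℝ E] [FiniteDimensional ℝ E]
  {E' : Type*} [NormedAddCommGroup E'] [NormedSpace ℝ E'] [FiniteDimensional ℝ E']

omit [FiniteDimensional ℝ E] in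
/-- Metrics that agree on an open set have the same curvature there. -/
theorem IsMetricOn.isIsometryOn_id {G G' : E → E →L[ℝ] E →L[ℝ] ℝ} {U : Set E}
    (h : IsMetricOn G U) (hG : ∀ y ∈ U, G' y = G y) : IsIsometryOn G' G U U id where
  source := h.congr hG
  target := h
  contDiffOn := contDiffOn_id
  mapsTo := Set.mapsTo_id U
  pullback y hy v w := by simp [hG y hy]

/-- Naturality for the identity map. It is needed because the chart metric of the product is known
to be a warped product only on the chart target. -/
theorem IsMetricOn.coordRiem_congr {G G' : E → E →L[ℝ] E →L[ℝ] ℝ} {U : Set E}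
    (h : IsMetricOn G U) (hG : ∀ y ∈ U, G' y = G y) {y : E} (hy : y ∈ U) (u v w t : E) :
    coordRiem G' y u v w t = coordRiem G y u v w t := by
  simpa using (h.isIsometryOn_id hG).coordRiem_eq hy u v w t

theorem IsMetricOn.coordCov4_congr {G G' : E → E →L[ℝ] E →L[ℝ] ℝ} {U : Set E}
    (h : IsMetricOn G U) (hG : ∀ y ∈ U, G' y = G y) {y : E} (hy : y ∈ U) (m u v w t : E) :
    coordCov4 G' (coordRiem G') y m u v w t = coordCov4 G (coordRiem G) y m u v w t := by
  simpa using (h.isIsometryOn_id hG).coordCov4_eq hy m u v w t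

theorem IsMetricOn.coordCov4_zero {G : E → E →L[ℝ] E →L[ℝ] ℝ} {U : Set E}
    (h : IsMetricOn G U) {y : E} (hy : y ∈ U) (u v w t : E) :
    coordCov4 G (coordRiem G) y 0 u v w t = 0 := by
  rw [h.coordCov4_coordRiem hy]
  simp [← christoffelL_apply]

namespace IsWarpedOn

variable {GB : E → E →L[ℝ] E →L[ℝ] ℝ} {f : E → ℝ} {GF : E' → E' →L[ℝ] E' →L[ℝ] ℝ}
  {U : Set E} {V : Set E'} (h : IsWarpedOn GB f GF U V)
include h

omit [FiniteDimensional ℝ E] [FiniteDimensional ℝ E'] in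
theorem coordCov2_zero {x : E} (hx : x ∈ U) (u v : E) :
    coordCov2 GB (coordT GB f) x 0 u v = 0 := by
  simp [coordCov2, ← christoffelL_apply, h.coordT_zero_left hx, h.coordT_zero_right hx]

variable {z : E × E'} (hz : z ∈ U ×ˢ V) {α : (E × E') →L[ℝ] ℝ}
  (hrec : ∀ m u v w t : E × E', coordCov4 (coordWarped GB f GF)
    (coordRiem (coordWarped GB f GF)) z m u v w t
      = α m * coordRiem (coordWarped GB f GF) z u v w t)
include hz hrec

/-- The direction m is any vector of the product: a base vector gives the recurrence of the base,
while a fiber vector gives zero on the left and hence constrains α. -/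
theorem rec_base (m : E × E') (u v w t : E) : coordCov4 GB (coordRiem GB) z.1 m.1 u v w t
    = α m * coordRiem GB z.1 u v w t := by
  rw [← h.cov_base m u v w t hz, hrec, h.isMetricOn.coordRiem_eq hz, h.riemL_coordWarped hz,
    h.base.coordRiem_eq hz.1]
  simp [coordGauss]

/-- A pair b, c with g̃(b,c) ≠ 0 exists by nondegeneracy, and the common factor f g̃(b,c) is
cancelled. -/
theorem rec_mixed [Nontrivial E'] (m : E × E') (u t : E) :
    coordCov2 GB (coordT GB f) z.1 m.1 u t = α m * coordT GB f z.1 u t := by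
  obtain ⟨b, hb⟩ := exists_ne (0 : E')
  obtain ⟨c, hc⟩ : ∃ c, GF z.2 b c ≠ 0 := by
    by_contra! hc
    exact hb (h.fiber.nondegenerate _ hz.2 b hc)
  have h1 := h.cov_mixed m u t b c hz
  rw [hrec, h.isMetricOn.coordRiem_eq hz, h.riemL_coordWarped hz] at h1
  simp only [coordGauss, map_zero, zero_apply, mul_zero, sub_zero, zero_mul, add_zero,
    h.coordT_zero_right hz.1, h.coordT_zero_left hz.1, zero_add, sub_self] at h1
  refine mul_right_cancel₀ (mul_ne_zero (h.pos _ hz.1).ne' hc) ?_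
  linarith

theorem rec_base_fiber (u : E) (a b c d : E') :
    fderiv ℝ f z.1 u * (coordRiem GF z.2 a b c d
      - f z.1 * coordP GB f z.1 * coordGauss GF z.2 a b c d)
      = f z.1 * coordT GB f z.1 u (coordGrad GB f z.1) * coordGauss GF z.2 a b c d := by
  have h1 := h.cov_base_fiber a u b c d hz
  have h2 : coordRiem (coordWarped GB f GF) z (u, 0) (0, b) (0, c) (0, d) = 0 := by
    rw [h.isMetricOn.coordRiem_eq hz, h.riemL_coordWarped hz]
    simp [coordGauss, h.coordT_zero_right hz.1]
  rw [hrec, h2, mul_zero] at h1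
  linarith

/-- In the direction (0,e) the base and mixed parts of ∇R vanish, so α(0,e) ≠ 0 annihilates the base
curvature and T. For P it is shown that df = 0. -/
theorem vanishing_of_fiber_ne_zero [Nontrivial E']
    (hR : ∃ u v w t, coordRiem (coordWarped GB f GF) z u v w t ≠ 0) {e : E'}
    (he : α (0, e) ≠ 0) : (∀ u v w t, coordRiem GB z.1 u v w t = 0)
      ∧ (∀ u v, coordT GB f z.1 u v = 0) ∧ coordP GB f z.1 = 0 := by
  have hB (u v w t : E) : coordRiem GB z.1 u v w t = 0 := by
    have h1 := h.rec_base hz hrec (0, e) u v w t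
    rw [h.base.coordCov4_zero hz.1] at h1
    exact (mul_eq_zero.1 h1.symm).resolve_left he
  have hT (u t : E) : coordT GB f z.1 u t = 0 := by
    have h1 := h.rec_mixed hz hrec (0, e) u t
    rw [h.coordCov2_zero hz.1] at h1
    exact (mul_eq_zero.1 h1.symm).resolve_left he
  -- If df(u) ≠ 0, then T = 0 in `rec_base_fiber` gives R̃ = fP G̃. The fiber terms of R cancel and
  -- R vanishes at z, against `hR`.
  have hf : fderiv ℝ f z.1 = 0 := by
    by_contra hf
    obtain ⟨u, hu⟩ : ∃ u, fderiv ℝ f z.1 u ≠ 0 := by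
      by_contra! hu
      exact hf (ContinuousLinearMap.ext hu)
    obtain ⟨a, b, c, d, hne⟩ := hR
    have h1 := h.rec_base_fiber hz hrec u a.2 b.2 c.2 d.2
    rw [hT, mul_zero, zero_mul] at h1
    have h2 := (mul_eq_zero.1 h1).resolve_left hu
    refine hne ?_
    rw [h.isMetricOn.coordRiem_eq hz, h.riemL_coordWarped hz, ← h.base.coordRiem_eq hz.1,
      ← h.fiber.coordRiem_eq hz.2, hB]
    simp only [hT]
    linear_combination f z.1 * h2
  exact ⟨hB, hT, by simp [coordP, hf]⟩

/-- Comparison of fiber components leaves the extra term α(0,e) f²P G̃, which vanishes because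
α(0,e) ≠ 0 forces P = 0. -/
theorem rec_fiber [Nontrivial E']
    (hR : ∃ u v w t, coordRiem (coordWarped GB f GF) z u v w t ≠ 0) (e a b c d : E') :
    coordCov4 GF (coordRiem GF) z.2 e a b c d = α (0, e) * coordRiem GF z.2 a b c d := by
  have h1 := h.cov_fiber e a b c d hz
  rw [hrec, h.isMetricOn.coordRiem_eq hz, h.riemL_coordWarped hz,
    ← h.fiber.coordRiem_eq hz.2] at h1
  simp only [map_zero, h.coordT_zero_right hz.1, zero_mul,
    sub_zero, add_zero, mul_zero, zero_add] at h1
  have h2 : α (0, e) * coordP GB f z.1 = 0 := by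
    by_cases he : α (0, e) = 0
    · rw [he, zero_mul]
    · rw [(h.vanishing_of_fiber_ne_zero hz hrec hR he).2.2, mul_zero]
  refine mul_left_cancel₀ (h.pos _ hz.1).ne' ?_
  linear_combination -h1 - f z.1 ^ 2 * coordGauss GF z.2 a b c d * h2

/-- With f locally constant, the fiber component of R is f R̃ and its covariant derivative along m
is zero, so α(m,0) f R̃ = 0. -/
theorem fiber_flat_of_fderiv_eq_zero (hf : ∀ x ∈ U, fderiv ℝ f x = 0) {m : E}
    (hm : α (m, 0) ≠ 0) (a b c d : E') : coordRiem GF z.2 a b c d = 0 := by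
  have h1 := h.cov_fiber_of_fderiv_eq_zero hf m a b c d hz
  rw [hrec, h.isMetricOn.coordRiem_eq hz, h.riemL_coordWarped hz,
    ← h.fiber.coordRiem_eq hz.2] at h1
  simpa [h.coordT_zero_right hz.1, coordP, hf _ hz.1, hm, (h.pos _ hz.1).ne'] using h1

end IsWarpedOn

end RecurrentWarped

/-! ### Product charts turn a warped product of manifolds into one of coordinate domains. -/

section WarpedCharts

set_option maxSynthPendingDepth 3

variable {E : Type*} [NormedAddCommGroup E] [NormedSpace ℝ E]
  {H : Type*} [TopologicalSpace H] {I : ModelWithCorners ℝ E H} [I.Boundaryless]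
  {B : Type*} [TopologicalSpace B] [ChartedSpace H B] [IsManifold I ∞ B]
  {E' : Type*} [NormedAddCommGroup E'] [NormedSpace ℝ E']
  {H' : Type*} [TopologicalSpace H'] {J : ModelWithCorners ℝ E' H'} [J.Boundaryless]
  {F : Type*} [TopologicalSpace F] [ChartedSpace H' F] [IsManifold J ∞ F]

omit [I.Boundaryless] [IsManifold I ∞ B] [J.Boundaryless] [IsManifold J ∞ F] in
theorem extChartAt_prod_target (z : B × F) : (extChartAt (I.prod J) z).target
    = (extChartAt I z.1).target ×ˢ (extChartAt J z.2).target := by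
  rw [extChartAt_prod]
  rfl

omit [I.Boundaryless] [IsManifold I ∞ B] [J.Boundaryless] [IsManifold J ∞ F] in
theorem extChartAt_prod_apply (z p : B × F) :
    extChartAt (I.prod J) z p = (extChartAt I z.1 p.1, extChartAt J z.2 p.2) := by
  rw [extChartAt_prod]
  rfl

omit [I.Boundaryless] [IsManifold I ∞ B] [J.Boundaryless] [IsManifold J ∞ F] in
theorem extChartAt_prod_symm_apply (z : B × F) (y : E × E') :
    (extChartAt (I.prod J) z).symm y
      = ((extChartAt I z.1).symm y.1, (extChartAt J z.2).symm y.2) := by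
  rw [extChartAt_prod]
  rfl

/-- Chain rule applied to both sides of the commuting square of projections and inverse charts. -/
theorem mfderiv_fst_extChartAt_prod_symm {z : B × F} {y : E × E'}
    (hy : y ∈ (extChartAt (I.prod J) z).target) (v : E × E') :
    mfderiv (I.prod J) I Prod.fst ((extChartAt (I.prod J) z).symm y)
        (mfderiv 𝓘(ℝ, E × E') (I.prod J) (extChartAt (I.prod J) z).symm y v)
      = mfderiv 𝓘(ℝ, E) I (extChartAt I z.1).symm y.1 v.1 := by
  have hy' : y ∈ (extChartAt I z.1).target ×ˢ (extChartAt J z.2).target := by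
    rwa [← extChartAt_prod_target]
  have h1 := mfderiv_comp y (I := 𝓘(ℝ, E × E')) (I' := I.prod J) (I'' := I)
    (g := (Prod.fst : B × F → B)) mdifferentiableAt_fst (mdifferentiableAt_extChartAt_symm hy)
  have h2 := mfderiv_comp y (I := 𝓘(ℝ, E × E')) (I' := 𝓘(ℝ, E)) (I'' := I)
    (g := (extChartAt I z.1).symm) (f := (Prod.fst : E × E' → E))
    (mdifferentiableAt_extChartAt_symm hy'.1) differentiableAt_fst.mdifferentiableAt
  have h3 : Prod.fst ∘ (extChartAt (I.prod J) z).symm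
      = (extChartAt I z.1).symm ∘ (Prod.fst : E × E' → E) := by
    funext a
    simp only [Function.comp_apply]
    rw [extChartAt_prod_symm_apply]
  rw [h3, h2, mfderiv_eq_fderiv, fderiv_fst] at h1
  exact (congrArg (fun L : (E × E') →L[ℝ] E => L v) h1).symm

theorem mfderiv_snd_extChartAt_prod_symm {z : B × F} {y : E × E'}
    (hy : y ∈ (extChartAt (I.prod J) z).target) (v : E × E') :
    mfderiv (I.prod J) J Prod.snd ((extChartAt (I.prod J) z).symm y)
        (mfderiv 𝓘(ℝ, E × E') (I.prod J) (extChartAt (I.prod J) z).symm y v)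
      = mfderiv 𝓘(ℝ, E') J (extChartAt J z.2).symm y.2 v.2 := by
  have hy' : y ∈ (extChartAt I z.1).target ×ˢ (extChartAt J z.2).target := by
    rwa [← extChartAt_prod_target]
  have h1 := mfderiv_comp y (I := 𝓘(ℝ, E × E')) (I' := I.prod J) (I'' := J)
    (g := (Prod.snd : B × F → F)) mdifferentiableAt_snd (mdifferentiableAt_extChartAt_symm hy)
  have h2 := mfderiv_comp y (I := 𝓘(ℝ, E × E')) (I' := 𝓘(ℝ, E')) (I'' := J)
    (g := (extChartAt J z.2).symm) (f := (Prod.snd : E × E' → E'))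
    (mdifferentiableAt_extChartAt_symm hy'.2) differentiableAt_snd.mdifferentiableAt
  have h3 : Prod.snd ∘ (extChartAt (I.prod J) z).symm
      = (extChartAt J z.2).symm ∘ (Prod.snd : E × E' → E') := by
    funext a
    simp only [Function.comp_apply]
    rw [extChartAt_prod_symm_apply]
  rw [h3, h2, mfderiv_eq_fderiv, fderiv_snd] at h1
  exact (congrArg (fun L : (E × E') →L[ℝ] E' => L v) h1).symm

theorem mfderiv_extChartAt_prod_symm {z : B × F} {y : E × E'}
    (hy : y ∈ (extChartAt (I.prod J) z).target) (v : E × E') :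
    mfderiv 𝓘(ℝ, E × E') (I.prod J) (extChartAt (I.prod J) z).symm y v
      = ((mfderiv 𝓘(ℝ, E) I (extChartAt I z.1).symm y.1 v.1,
        mfderiv 𝓘(ℝ, E') J (extChartAt J z.2).symm y.2 v.2) : E × E') := by
  have h1 := mfderiv_fst_extChartAt_prod_symm hy v
  have h2 := mfderiv_snd_extChartAt_prod_symm hy v
  rw [mfderiv_fst] at h1
  rw [mfderiv_snd] at h2
  exact Prod.ext h1 h2

variable {gB : ∀ x : B, TangentSpace I x →L[ℝ] TangentSpace I x →L[ℝ] ℝ} {f : B → ℝ}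
  {gF : ∀ y : F, TangentSpace J y →L[ℝ] TangentSpace J y →L[ℝ] ℝ}

/-- In product charts, the warped product metric is the warped product of the chart metrics. -/
theorem chartMetric_warpedMetric (z : B × F) {y : E × E'}
    (hy : y ∈ (extChartAt (I.prod J) z).target) :
    chartMetric (warpedMetric gB f gF) z y = coordWarped (chartMetric gB z.1)
      (f ∘ (extChartAt I z.1).symm) (chartMetric gF z.2) y := by
  refine ContinuousLinearMap.ext fun v => ContinuousLinearMap.ext fun w => ?_
  have e := extChartAt_prod_symm_apply (I := I) (J := J) z y
  rw [coordWarped_apply, chartMetric_apply, chartMetric_apply, chartMetric_apply,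
    ← mfderiv_fst_extChartAt_prod_symm hy, ← mfderiv_fst_extChartAt_prod_symm hy,
    ← mfderiv_snd_extChartAt_prod_symm hy, ← mfderiv_snd_extChartAt_prod_symm hy]
  exact congrArg₂ (· + ·) (form_congr gB (congrArg Prod.fst e) _ _)
    (congrArg₂ (· * ·) (congrArg f (congrArg Prod.fst e))
      (form_congr gF (congrArg Prod.snd e) _ _))

theorem isWarpedOn_chart (hgB : IsSemiRiemannianMetric I gB) (hgF : IsSemiRiemannianMetric J gF)
    (hf : ContMDiff I 𝓘(ℝ, ℝ) ∞ f) (hfpos : ∀ x, 0 < f x) (z : B × F) :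
    IsWarpedOn (chartMetric gB z.1) (f ∘ (extChartAt I z.1).symm) (chartMetric gF z.2)
      (extChartAt I z.1).target (extChartAt J z.2).target where
  base := hgB.isMetricOn_chartMetric z.1
  fiber := hgF.isMetricOn_chartMetric z.2
  contDiffOn := (contMDiffOn_source_iff f z.1).1 hf.contMDiffOn
  pos _ _ := hfpos _

theorem isMetricOn_chartMetric_warpedMetric (hgB : IsSemiRiemannianMetric I gB)
    (hgF : IsSemiRiemannianMetric J gF) (hf : ContMDiff I 𝓘(ℝ, ℝ) ∞ f) (hfpos : ∀ x, 0 < f x)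
    (z : B × F) : IsMetricOn (chartMetric (warpedMetric gB f gF) z)
      (extChartAt (I.prod J) z).target := by
  have h := (isWarpedOn_chart hgB hgF hf hfpos z).isMetricOn
  rw [← extChartAt_prod_target] at h
  exact h.congr fun y hy => chartMetric_warpedMetric z hy

omit [IsManifold I ∞ B] in
theorem differential_eq_fderiv (hf : MDifferentiable I 𝓘(ℝ, ℝ) f) (x : B) :
    differential (I := I) f x = fderiv ℝ (f ∘ (extChartAt I x).symm) (extChartAt I x x) := by
  have h1 := (hf x).mfderiv
  rw [I.range_eq_univ, fderivWithin_univ] at h1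
  exact h1

theorem fderiv_eq_zero_of_differential_eq_zero (hf : MDifferentiable I 𝓘(ℝ, ℝ) f)
    (h0 : ∀ x, differential (I := I) f x = 0) (x : B) {y : E} (hy : y ∈ (extChartAt I x).target) :
    fderiv ℝ (f ∘ (extChartAt I x).symm) y = 0 := by
  have h1 := mfderiv_comp y (I := 𝓘(ℝ, E)) (hf _) (mdifferentiableAt_extChartAt_symm hy)
  have h2 : mfderiv I 𝓘(ℝ, ℝ) f ((extChartAt I x).symm y) = 0 := h0 _
  rw [h2, mfderiv_eq_fderiv] at h1
  exact h1.trans (ContinuousLinearMap.zero_comp _)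

theorem warpP_eq_coordP (hf : MDifferentiable I 𝓘(ℝ, ℝ) f) (x : B) : warpP gB f x
    = coordP (chartMetric gB x) (f ∘ (extChartAt I x).symm) (extChartAt I x x) := by
  rw [warpP, coordP, coordGrad, differential_eq_fderiv hf, chartMetric_self, Function.comp_apply,
    extChartAt_to_inv]
  rfl

/-- The restriction of a smooth 1-form to a slice `B × {y}` is smooth. -/
theorem isSmoothOneForm_basePart {θ : ∀ z : B × F, TangentSpace (I.prod J) z →L[ℝ] ℝ}
    (hθ : IsSmoothOneForm (I.prod J) θ) (y : F) :
    IsSmoothOneForm I fun x => basePart θ (x, y) := by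
  refine (isSmoothOneForm_iff _).2 fun x => ?_
  have h1 := (isSmoothOneForm_iff θ).1 hθ (x, y)
  have h2 : ContDiffOn ℝ ∞ (fun a : E => (a, extChartAt J y y)) (extChartAt I x).target :=
    contDiffOn_id.prodMk contDiffOn_const
  have hmem : ∀ a ∈ (extChartAt I x).target,
      (a, extChartAt J y y) ∈ (extChartAt (I.prod J) (x, y)).target := fun a ha => by
    rw [extChartAt_prod_target]
    exact ⟨ha, mem_extChartAt_target y⟩
  refine ((h1.comp h2 hmem).clm_comp
    (contDiffOn_const (c := ContinuousLinearMap.inl ℝ E E'))).congr fun a ha => ?_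
  refine ContinuousLinearMap.ext fun v => ?_
  have hp : (extChartAt (I.prod J) (x, y)).symm (a, extChartAt J y y) = ((extChartAt I x).symm a, y) := by
    rw [extChartAt_prod_symm_apply]
    simp only [extChartAt_to_inv]
  have hv : mfderiv 𝓘(ℝ, E × E') (I.prod J) (extChartAt (I.prod J) (x, y)).symm
      (a, extChartAt J y y) (v, 0) = ((mfderiv 𝓘(ℝ, E) I (extChartAt I x).symm a v, 0) : E × E') := by
    rw [mfderiv_extChartAt_prod_symm (hmem a ha)]
    exact Prod.ext rfl (map_zero _)
  refine Eq.trans ?_ (congrArg (θ _) hv).symm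
  exact oneForm_congr θ hp.symm _

/-- The restriction of a smooth 1-form to a slice `{x} × F` is smooth. -/
theorem isSmoothOneForm_fiberPart {θ : ∀ z : B × F, TangentSpace (I.prod J) z →L[ℝ] ℝ}
    (hθ : IsSmoothOneForm (I.prod J) θ) (x : B) :
    IsSmoothOneForm J fun y => fiberPart θ (x, y) := by
  refine (isSmoothOneForm_iff _).2 fun y => ?_
  have h1 := (isSmoothOneForm_iff θ).1 hθ (x, y)
  have h2 : ContDiffOn ℝ ∞ (fun a : E' => (extChartAt I x x, a)) (extChartAt J y).target :=
    contDiffOn_const.prodMk contDiffOn_id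
  have hmem : ∀ a ∈ (extChartAt J y).target,
      (extChartAt I x x, a) ∈ (extChartAt (I.prod J) (x, y)).target := fun a ha => by
    rw [extChartAt_prod_target]
    exact ⟨mem_extChartAt_target x, ha⟩
  refine ((h1.comp h2 hmem).clm_comp
    (contDiffOn_const (c := ContinuousLinearMap.inr ℝ E E'))).congr fun a ha => ?_
  refine ContinuousLinearMap.ext fun v => ?_
  have hp : (extChartAt (I.prod J) (x, y)).symm (extChartAt I x x, a) = (x, (extChartAt J y).symm a) := by
    rw [extChartAt_prod_symm_apply]
    simp only [extChartAt_to_inv]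
  have hv : mfderiv 𝓘(ℝ, E × E') (I.prod J) (extChartAt (I.prod J) (x, y)).symm
      (extChartAt I x x, a) (0, v) = ((0, mfderiv 𝓘(ℝ, E') J (extChartAt J y).symm a v) : E × E') := by
    rw [mfderiv_extChartAt_prod_symm (hmem a ha)]
    exact Prod.ext (map_zero _) rfl
  refine Eq.trans ?_ (congrArg (θ _) hv).symm
  exact oneForm_congr θ hp.symm _

end WarpedCharts

/-! ### R and ∇R of the warped manifold in product coordinates. -/

section RecurrentWarpedManifold

variable {E : Type*} [NormedAddCommGroup E] [NormedSpace ℝ E] [FiniteDimensional ℝ E]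
  {H : Type*} [TopologicalSpace H] {I : ModelWithCorners ℝ E H} [I.Boundaryless]
  {B : Type*} [TopologicalSpace B] [ChartedSpace H B] [IsManifold I ∞ B]
  {E' : Type*} [NormedAddCommGroup E'] [NormedSpace ℝ E'] [FiniteDimensional ℝ E']
  {H' : Type*} [TopologicalSpace H'] {J : ModelWithCorners ℝ E' H'} [J.Boundaryless]
  {F : Type*} [TopologicalSpace F] [ChartedSpace H' F] [IsManifold J ∞ F]
  {gB : ∀ x : B, TangentSpace I x →L[ℝ] TangentSpace I x →L[ℝ] ℝ} {f : B → ℝ}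
  {gF : ∀ y : F, TangentSpace J y →L[ℝ] TangentSpace J y →L[ℝ] ℝ}
  (hgB : IsSemiRiemannianMetric I gB) (hgF : IsSemiRiemannianMetric J gF)
  (hf : ContMDiff I 𝓘(ℝ, ℝ) ∞ f) (hfpos : ∀ x, 0 < f x)
include hgB hgF hf hfpos

/-- The curvature of a warped product at `z`, computed from the warped product of the
chart metrics. -/
theorem riem_warpedMetric (z : B × F) (u v w t : E × E') :
    riem (warpedMetric gB f gF) z u v w t = coordRiem (coordWarped (chartMetric gB z.1)
      (f ∘ (extChartAt I z.1).symm) (chartMetric gF z.2))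
      (extChartAt I z.1 z.1, extChartAt J z.2 z.2) u v w t := by
  have h := (isWarpedOn_chart hgB hgF hf hfpos z).isMetricOn
  rw [← extChartAt_prod_target] at h
  rw [← extChartAt_prod_apply z z]
  exact h.coordRiem_congr (fun y hy => chartMetric_warpedMetric z hy)
    (mem_extChartAt_target z) u v w t

theorem covRiem_warpedMetric (z : B × F) (m u v w t : E × E') :
    covRiem (warpedMetric gB f gF) z m u v w t = coordCov4 (coordWarped (chartMetric gB z.1)
      (f ∘ (extChartAt I z.1).symm) (chartMetric gF z.2)) (coordRiem (coordWarped
        (chartMetric gB z.1) (f ∘ (extChartAt I z.1).symm) (chartMetric gF z.2)))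
      (extChartAt I z.1 z.1, extChartAt J z.2 z.2) m u v w t := by
  have h := (isWarpedOn_chart hgB hgF hf hfpos z).isMetricOn
  rw [← extChartAt_prod_target] at h
  rw [← extChartAt_prod_apply z z]
  exact h.coordCov4_congr (fun y hy => chartMetric_warpedMetric z hy)
    (mem_extChartAt_target z) m u v w t

end RecurrentWarpedManifold

end SemiRiem

end

/-! ### The global statement. -/

theorem corollary4p5 {p q : ℕ} (hp : 1 ≤ p) (hq : 1 ≤ q) (hn : 3 ≤ p + q)
    {B : Type*} [TopologicalSpace B] [T2Space B] [SecondCountableTopology B] [ConnectedSpace B]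
    [ChartedSpace (EuclideanSpace ℝ (Fin p)) B] [IsManifold (𝓡 p) ∞ B]
    {F : Type*} [TopologicalSpace F] [T2Space F] [SecondCountableTopology F] [ConnectedSpace F]
    [ChartedSpace (EuclideanSpace ℝ (Fin q)) F] [IsManifold (𝓡 q) ∞ F]
    (gB : ∀ x : B, TangentSpace (𝓡 p) x →L[ℝ] TangentSpace (𝓡 p) x →L[ℝ] ℝ)
    (hgB : IsSemiRiemannianMetric (𝓡 p) gB)
    (gF : ∀ y : F, TangentSpace (𝓡 q) y →L[ℝ] TangentSpace (𝓡 q) y →L[ℝ] ℝ)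
    (hgF : IsSemiRiemannianMetric (𝓡 q) gF)
    (f : B → ℝ) (hf : ContMDiff (𝓡 p) 𝓘(ℝ, ℝ) ∞ f) (hfpos : ∀ x, 0 < f x)
    -- the warped product is not flat
    (hR : ∃ z, ∃ u v w t, riem (warpedMetric gB f gF) z u v w t ≠ 0)
    -- the warped product is recurrent with associated 1-form `θ`
    (θ : ∀ z : B × F, TangentSpace ((𝓡 p).prod (𝓡 q)) z →L[ℝ] ℝ)
    (hθ : IsSmoothOneForm ((𝓡 p).prod (𝓡 q)) θ)
    (hrec : ∀ z m u v w t, covRiem (warpedMetric gB f gF) z m u v w t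
      = θ z m * riem (warpedMetric gB f gF) z u v w t) :
    -- (i) base and fiber are recurrent, with the respective parts of `θ`
    (IsRecurrent gB ∧ IsRecurrent gF
      ∧ (∀ z : B × F, ∀ m u v w t,
          covRiem gB z.1 m u v w t = basePart θ z m * riem gB z.1 u v w t)
      ∧ (∀ z : B × F, ∀ m u v w t,
          covRiem gF z.2 m u v w t = fiberPart θ z m * riem gF z.2 u v w t))
    -- `T` is recurrent, with the same 1-form
    ∧ (∀ z : B × F, ∀ m u v,
        covWarpT gB f z.1 m u v = basePart θ z m * warpT gB f z.1 u v)
    -- (ii)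
    ∧ (∀ z : B × F, fiberPart θ z ≠ 0 →
        (∀ u v w t, riem gB z.1 u v w t = 0) ∧ (∀ u v, warpT gB f z.1 u v = 0)
          ∧ warpP gB f z.1 = 0)
    -- (iii)
    ∧ (∃ k : ℝ, ∀ z : B × F,
        (differential (I := 𝓡 p) f z.1 ≠ 0 ∨ differential (I := 𝓡 p) f z.1 + f z.1 • basePart θ z ≠ 0) →
          ∀ u v w t, riem gF z.2 u v w t = k * gaussTensor gF z.2 u v w t) := by
  have := Fin.pos_iff_nonempty.1 hq
  have hnt : Nontrivial (EuclideanSpace ℝ (Fin q)) := inferInstance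
  have hfd : MDifferentiable (𝓡 p) 𝓘(ℝ, ℝ) f := hf.mdifferentiable (by simp)
  have hne := riem_ne_zero_of_recurrent
    (isMetricOn_chartMetric_warpedMetric hgB hgF hf hfpos) hθ hrec hR
  have hW := isWarpedOn_chart hgB hgF hf hfpos
  have hmem (z : B × F) : (extChartAt (𝓡 p) z.1 z.1, extChartAt (𝓡 q) z.2 z.2)
      ∈ (extChartAt (𝓡 p) z.1).target ×ˢ (extChartAt (𝓡 q) z.2).target :=
    ⟨mem_extChartAt_target _, mem_extChartAt_target _⟩
  -- The recurrence at z, rewritten for the coordinate warped product at the chart image of z, where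
  -- the pointwise lemmas apply.
  have hrec' (z : B × F) (m u v w t : EuclideanSpace ℝ (Fin p) × EuclideanSpace ℝ (Fin q)) :=
    ((covRiem_warpedMetric hgB hgF hf hfpos z m u v w t).symm.trans (hrec z m u v w t)).trans
      (congrArg (θ z m * ·) (riem_warpedMetric hgB hgF hf hfpos z u v w t))
  have hne' (z : B × F) : ∃ u v w t, coordRiem (coordWarped (chartMetric gB z.1)
      (f ∘ (extChartAt (𝓡 p) z.1).symm) (chartMetric gF z.2))
      (extChartAt (𝓡 p) z.1 z.1, extChartAt (𝓡 q) z.2 z.2) u v w t ≠ 0 := by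
    obtain ⟨u, v, w, t, h0⟩ := hne z
    exact ⟨u, v, w, t, fun h1 => h0 ((riem_warpedMetric hgB hgF hf hfpos z u v w t).trans h1)⟩
  have base (z : B × F) (m u v w t : EuclideanSpace ℝ (Fin p)) :
      covRiem gB z.1 m u v w t = basePart θ z m * riem gB z.1 u v w t :=
    (hW z).rec_base (hmem z) (hrec' z) (m, 0) u v w t
  have fiber (z : B × F) (m u v w t : EuclideanSpace ℝ (Fin q)) :
      covRiem gF z.2 m u v w t = fiberPart θ z m * riem gF z.2 u v w t :=
    (hW z).rec_fiber (hmem z) (hrec' z) (hne' z) m u v w t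
  have gauss (y : F) (u v w t : EuclideanSpace ℝ (Fin q)) :
      gaussTensor gF y u v w t
        = coordGauss (chartMetric gF y) (extChartAt (𝓡 q) y y) u v w t := by
    rw [coordGauss, chartMetric_self]
    rfl
  obtain ⟨x₀⟩ : Nonempty B := inferInstance
  obtain ⟨y₀⟩ : Nonempty F := inferInstance
  refine ⟨⟨?_, ?_, base, fiber⟩, ?_, ?_, ?_⟩
  -- The recurrence holds over every point of the fiber, so restricting θ to a single slice provides
  -- a 1-form on the base.
  · exact ⟨fun x => basePart θ (x, y₀), isSmoothOneForm_basePart hθ y₀,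
      fun x _ => base (x, y₀)⟩
  · exact ⟨fun y => fiberPart θ (x₀, y), isSmoothOneForm_fiberPart hθ x₀,
      fun y _ => fiber (x₀, y)⟩
  · exact fun z m u v => (hW z).rec_mixed (hmem z) (hrec' z) (m, 0) u v
  · intro z hz
    obtain ⟨e, he⟩ : ∃ e, fiberPart θ z e ≠ 0 := by
      by_contra! he
      exact hz (ContinuousLinearMap.ext he)
    have he' : θ z ((0, e) : EuclideanSpace ℝ (Fin p) × EuclideanSpace ℝ (Fin q)) ≠ 0 := he
    obtain ⟨h1, h2, h3⟩ :=
      (hW z).vanishing_of_fiber_ne_zero (hmem z) (hrec' z) (hne' z) (e := e) he'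
    exact ⟨h1, h2, (warpP_eq_coordP hfd z.1).trans h3⟩
  -- If df ≡ 0, the set in question is where the base part of θ is nonzero, and k = 0 works there.
  -- Otherwise one base point with df ≠ 0 determines the curvature of the entire fiber.
  · by_cases h0 : ∀ x, differential (I := 𝓡 p) f x = 0
    · refine ⟨0, fun z hz u v w t => ?_⟩
      have hz' : basePart θ z ≠ 0 := by
        rintro h1
        rcases hz with hz | hz
        · exact hz (h0 _)
        · exact hz (by rw [h0, h1, smul_zero, add_zero])
      obtain ⟨m, hm⟩ : ∃ m, basePart θ z m ≠ 0 := by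
        by_contra! hm
        exact hz' (ContinuousLinearMap.ext hm)
      rw [zero_mul]
      exact (hW z).fiber_flat_of_fderiv_eq_zero (hmem z) (hrec' z)
        (fun x hx => fderiv_eq_zero_of_differential_eq_zero hfd h0 z.1 hx) hm u v w t
    · push Not at h0
      obtain ⟨x, hx⟩ := h0
      rw [differential_eq_fderiv hfd] at hx
      obtain ⟨u, hu⟩ : ∃ u, fderiv ℝ (f ∘ (extChartAt (𝓡 p) x).symm) (extChartAt (𝓡 p) x x) u
          ≠ 0 := by
        by_contra! hu
        exact hx (ContinuousLinearMap.ext hu)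
      set φ := f ∘ (extChartAt (𝓡 p) x).symm
      set a := extChartAt (𝓡 p) x x
      have h1 (y : F) (b c d e : EuclideanSpace ℝ (Fin q)) :
          fderiv ℝ φ a u * (riem gF y b c d e
            - φ a * coordP (chartMetric gB x) φ a * gaussTensor gF y b c d e)
          = φ a * coordT (chartMetric gB x) φ a u (coordGrad (chartMetric gB x) φ a)
            * gaussTensor gF y b c d e := by
        rw [gauss]
        exact (hW (x, y)).rec_base_fiber (hmem (x, y)) (hrec' (x, y)) u b c d e
      -- The constant comes from solving `h1` for the fiber curvature after division by df(u). It
      -- involves only x and u, so it is the same for every y.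
      refine ⟨φ a * coordP (chartMetric gB x) φ a + φ a * coordT (chartMetric gB x) φ a u
        (coordGrad (chartMetric gB x) φ a) / fderiv ℝ φ a u, fun z _ b c d e => ?_⟩
      rw [add_mul, ← sub_eq_iff_eq_add', div_mul_eq_mul_div, eq_div_iff hu, mul_comm]
      exact h1 z.2 b c d e
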